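/- Let $X$ be a smooth manifold of dimension $n$ (Hausdorff, second countable, without boundary) and $Z\subset X$ a closed smooth hypersurface (embedded submanifold of codimension one), with vanishing ideal sheaf $I_Z\subset C^\infty_X$; such a pair is called a log pair. A log divisor with zero set $Z$ is a pair $(L_Z,s)$ of a smooth real line bundle $L_Z\to X$ and a smooth section $s$ of $L_Z$ that is transverse to the zero section and satisfies $s^{-1}(0)=Z$ (nowhere dense). The log-tangent bundle $\mathcal A_Z=TX(-\log Z)$ is the smooth vector bundle, with anchor map to $TX$, whose sheaf of sections is, via the anchor, the sheaf of vector fields $v$ with $\mathcal L_v I_Z\subseteq I_Z$. For $k\ge 1$, a $(k-1)$-jet at $Z$ is a global section $j$ of the restriction to $Z$ of the sheaf $C^\infty_X/I_Z^{k}$; given a $(k-1)$-jet $j$ that is represented near each point of $Z$ by a local defining function of $Z$ (a function $z$ with zero set $Z$ and $dz\neq 0$ along $Z$), the $b^k$-tangent bundle $\mathcal A_Z^k$ is the smooth vector bundle, with anchor map to $TX$, whose sheaf of sections is, via the anchor, the sheaf of vector fields $v$ such that $\mathcal L_v f\in I_Z^k$ for all local functions $f$ representing $j$. Then: 1. A log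 divisor $(L_Z,s)$ with zero set $Z$ and a log-tangent bundle $\mathcal A_Z$ exist, and for every choice of them there is an isomorphism of smooth vector bundles over $X$ $$\mathcal A_Z\oplus L_Z\;\cong\; TX\oplus\underline{\mathbb R}.$$ 2. For every $k\ge 1$ and every $(k-1)$-jet $j$ as above, a $b^k$-tangent bundle $\mathcal A_Z^k$ exists, and for every choice of it and of a log divisor $(L_Z,s)$ with zero set $Z$ there is an isomorphism of smooth vector bundles over $X$ $$\mathcal A_Z^k\oplus L_Z^{\otimes k}\;\cong\; TX\oplus\underline{\mathbb R}.$$ -/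

import Mathlib

open Set Filter Topology Bundle
open scoped Manifold ContDiff

noncomputable section

/-! ## Smooth real vector bundles -/

/-- A smooth real vector bundle of finite rank over the smooth `n`-manifold `X`: a family of
fibres `E` with typical fibre `F` and smooth transition functions. -/
structure SmoothVB (n : ℕ) (X : Type*) [TopologicalSpace X]
    [ChartedSpace (EuclideanSpace ℝ (Fin n)) X] where
  F : Type
  E : X → Type
  [normedAddCommGroupF : NormedAddCommGroup F]
  [normedSpaceF : NormedSpace ℝ F]
  [finiteDimensionalF : FiniteDimensional ℝ F]
  [addCommGroupE : ∀ x, AddCommGroup (E x)]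
  [moduleE : ∀ x, Module ℝ (E x)]
  [topologicalSpaceE : ∀ x, TopologicalSpace (E x)]
  [topologicalSpaceTotal : TopologicalSpace (TotalSpace F E)]
  [fiberBundle : FiberBundle F E]
  [vectorBundle : VectorBundle ℝ F E]
  [contMDiffVectorBundle : ContMDiffVectorBundle ∞ F E (𝓡 n)]

namespace SmoothVB

attribute [instance] normedAddCommGroupF normedSpaceF finiteDimensionalF addCommGroupE moduleE
  topologicalSpaceE topologicalSpaceTotal fiberBundle vectorBundle contMDiffVectorBundle

variable {n : ℕ} {X : Type*} [TopologicalSpace X] [ChartedSpace (EuclideanSpace ℝ (Fin n)) X]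

instance instIsTopologicalAddGroupFibre (A : SmoothVB n X) (x : X) :
    IsTopologicalAddGroup (A.E x) :=
  (VectorBundle.continuousLinearEquivAt ℝ A.F A.E x).toContinuousAddEquiv.isTopologicalAddGroup

instance instContinuousSMulFibre (A : SmoothVB n X) (x : X) : ContinuousSMul ℝ (A.E x) :=
  (VectorBundle.continuousLinearEquivAt ℝ A.F A.E x).continuousSMul

/-- The total space of a smooth vector bundle. -/
abbrev Total (A : SmoothVB n X) := TotalSpace A.F A.E

/-- The (set-theoretic) section `s` of `A` is smooth on the subset `U`. -/
def SmoothSectionOn (A : SmoothVB n X) (U : Set X) (s : ∀ x, A.E x) : Prop :=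
  ContMDiffOn (𝓡 n) ((𝓡 n).prod 𝓘(ℝ, A.F)) ∞ (fun x => (⟨x, s x⟩ : A.Total)) U

/-- An isomorphism of smooth vector bundles over the identity of `X`: fibrewise linear
isomorphisms which together form a diffeomorphism of total spaces. -/
structure Iso (A B : SmoothVB n X) where
  equiv : ∀ x, A.E x ≃ₗ[ℝ] B.E x
  smooth : ContMDiff ((𝓡 n).prod 𝓘(ℝ, A.F)) ((𝓡 n).prod 𝓘(ℝ, B.F)) ∞
    (fun a : A.Total => (⟨a.1, equiv a.1 a.2⟩ : B.Total))
  smooth_symm : ContMDiff ((𝓡 n).prod 𝓘(ℝ, B.F)) ((𝓡 n).prod 𝓘(ℝ, A.F)) ∞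
    (fun b : B.Total => (⟨b.1, (equiv b.1).symm b.2⟩ : A.Total))

/-- The trivial line bundle `X × ℝ`. -/
abbrev trivialLine (n : ℕ) (X : Type*) [TopologicalSpace X]
    [ChartedSpace (EuclideanSpace ℝ (Fin n)) X] : SmoothVB n X where
  F := ℝ
  E := Bundle.Trivial X ℝ

variable [IsManifold (𝓡 n) ∞ X]

/-- The tangent bundle `TX`. -/
abbrev tangent (n : ℕ) (X : Type*) [TopologicalSpace X]
    [ChartedSpace (EuclideanSpace ℝ (Fin n)) X] [IsManifold (𝓡 n) ∞ X] : SmoothVB n X where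
  F := EuclideanSpace ℝ (Fin n)
  E := TangentSpace (𝓡 n)

/-- The direct (Whitney) sum `A ⊕ B`. -/
abbrev sum (A B : SmoothVB n X) : SmoothVB n X where
  F := A.F × B.F
  E := A.E ×ᵇ B.E

/-- The bundle `Hom(A, B)`. -/
abbrev hom (A B : SmoothVB n X) : SmoothVB n X where
  F := A.F →L[ℝ] B.F
  E := fun x => A.E x →L[ℝ] B.E x

/-- The tensor product `A ⊗ B` of vector bundles of finite rank, realised as `Hom(A*, B)`;
the decomposable tensor `a ⊗ b` is the map `φ ↦ φ(a) b`. -/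
abbrev tensor (A B : SmoothVB n X) : SmoothVB n X :=
  hom (hom A (trivialLine n X)) B

/-- The tensor power `L ^ k = L ⊗ (L ⊗ (⋯ ⊗ ℝ))`. -/
def tensorPow (L : SmoothVB n X) : ℕ → SmoothVB n X
  | 0 => trivialLine n X
  | k + 1 => tensor L (tensorPow L k)

end SmoothVB

/-! ## Germs, the vanishing ideal of a subset, and its powers -/

section Germs

variable (n : ℕ) {X : Type*} [TopologicalSpace X] [ChartedSpace (EuclideanSpace ℝ (Fin n)) X]

/-- The stalk at `p` of the sheaf of smooth real functions, as a ring of germs of functions. -/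
def smoothGerms (p : X) : Subring (Germ (𝓝 p) ℝ) where
  carrier := {φ | ∃ f : X → ℝ, (f : Germ (𝓝 p) ℝ) = φ ∧
    ∀ᶠ x in 𝓝 p, ContMDiffAt (𝓡 n) 𝓘(ℝ, ℝ) ∞ f x}
  mul_mem' := by
    rintro _ _ ⟨f, rfl, hf⟩ ⟨g, rfl, hg⟩
    refine ⟨f * g, rfl, ?_⟩
    filter_upwards [hf, hg] with x h₁ h₂ using h₁.mul h₂
  one_mem' := ⟨1, rfl, Eventually.of_forall fun _ => contMDiffAt_const⟩
  add_mem' := by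
    rintro _ _ ⟨f, rfl, hf⟩ ⟨g, rfl, hg⟩
    refine ⟨f + g, rfl, ?_⟩
    filter_upwards [hf, hg] with x h₁ h₂ using h₁.add h₂
  zero_mem' := ⟨0, rfl, Eventually.of_forall fun _ => contMDiffAt_const⟩
  neg_mem' := by
    rintro _ ⟨f, rfl, hf⟩
    refine ⟨-f, rfl, ?_⟩
    filter_upwards [hf] with x h₁ using h₁.neg

/-- The stalk at `p` of the vanishing ideal sheaf `I_Z`: germs of smooth functions vanishing
on `Z`. -/
def vanishingGerms (Z : Set X) (p : X) : Ideal (smoothGerms n p) where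
  carrier := {φ | ∃ f : X → ℝ, (f : Germ (𝓝 p) ℝ) = φ.1 ∧ ∀ᶠ x in 𝓝 p, x ∈ Z → f x = 0}
  add_mem' := by
    rintro ⟨_, _⟩ ⟨_, _⟩ ⟨f, rfl, hf⟩ ⟨g, rfl, hg⟩
    refine ⟨f + g, rfl, ?_⟩
    filter_upwards [hf, hg] with x h₁ h₂ hx
    simp [h₁ hx, h₂ hx]
  zero_mem' := ⟨0, rfl, Eventually.of_forall fun _ _ => rfl⟩
  smul_mem' := by
    rintro ⟨_, ⟨c, rfl, _⟩⟩ ⟨_, _⟩ ⟨f, rfl, hf⟩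
    refine ⟨c * f, rfl, ?_⟩
    filter_upwards [hf] with x h₁ hx
    simp [h₁ hx]

/-- `f` is a section over `U` of the `k`-th power `I_Z ^ k` of the vanishing ideal sheaf of `Z`
(membership in a sheaf of ideals is tested on stalks). -/
def MemIdealPow (Z : Set X) (k : ℕ) (U : Set X) (f : X → ℝ) : Prop :=
  ∀ p ∈ U, ∃ φ ∈ vanishingGerms n Z p ^ k, (f : Germ (𝓝 p) ℝ) = φ.1

/-- A local defining function for `Z` on the open set `U`. -/
structure IsLocalDefiningFunction (Z U : Set X) (f : X → ℝ) : Prop where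
  smooth : ContMDiffOn (𝓡 n) 𝓘(ℝ, ℝ) ∞ f U
  zero_iff : ∀ x ∈ U, f x = 0 ↔ x ∈ Z
  mfderiv_ne_zero : ∀ x ∈ U, x ∈ Z → mfderiv (𝓡 n) 𝓘(ℝ, ℝ) f x ≠ 0

/-- `Z` is a (closed, smooth, embedded) hypersurface of `X`; equivalently `(X, Z)` is a log
pair. -/
structure IsHypersurface (Z : Set X) : Prop where
  isClosed : IsClosed Z
  locally_defined : ∀ p ∈ Z, ∃ U : Set X, IsOpen U ∧ p ∈ U ∧
    ∃ f : X → ℝ, IsLocalDefiningFunction n Z U f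

/-! ## Jets along a hypersurface -/

/-- An `m`-jet at `Z`: a global section of the inverse image to `Z` of the quotient sheaf
`C^∞ / I_Z ^ (m + 1)`, i.e. a family of elements of the stalks at the points of `Z` which locally
comes from smooth functions. -/
structure JetAlong (Z : Set X) (m : ℕ) where
  val : ∀ p : Z, smoothGerms n (p : X) ⧸ vanishingGerms n Z (p : X) ^ (m + 1)
  locally_represented : ∀ p : Z, ∃ U : Set X, IsOpen U ∧ (p : X) ∈ U ∧ ∃ f : X → ℝ,
    ContMDiffOn (𝓡 n) 𝓘(ℝ, ℝ) ∞ f U ∧ ∀ q : Z, (q : X) ∈ U →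
      ∃ φ : smoothGerms n (q : X), (f : Germ (𝓝 (q : X)) ℝ) = φ.1 ∧
        Ideal.Quotient.mk (vanishingGerms n Z (q : X) ^ (m + 1)) φ = val q

variable {n}

/-- `f ∈ j` over the open set `U`: the smooth function `f` on `U` represents the jet `j`. -/
def JetAlong.Represents {Z : Set X} {m : ℕ} (j : JetAlong n Z m) (U : Set X) (f : X → ℝ) : Prop :=
  ContMDiffOn (𝓡 n) 𝓘(ℝ, ℝ) ∞ f U ∧ ∀ q : Z, (q : X) ∈ U →
    ∃ φ : smoothGerms n (q : X), (f : Germ (𝓝 (q : X)) ℝ) = φ.1 ∧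
      Ideal.Quotient.mk (vanishingGerms n Z (q : X) ^ (m + 1)) φ = j.val q

/-- The jet `j` is locally represented by local defining functions of `Z`. -/
def JetAlong.IsDefining {Z : Set X} {m : ℕ} (j : JetAlong n Z m) : Prop :=
  ∀ p ∈ Z, ∃ U : Set X, IsOpen U ∧ p ∈ U ∧
    ∃ f : X → ℝ, IsLocalDefiningFunction n Z U f ∧ j.Represents U f

/-! ## Sheaves of vector fields and the associated bundles -/

/-- The Lie derivative `L_v f = df(v)` of a function along a vector field. -/
def lieDerivFun (v : ∀ x : X, TangentSpace (𝓡 n) x) (f : X → ℝ) : X → ℝ :=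
  fun x => mfderiv (𝓡 n) 𝓘(ℝ, ℝ) f x (v x)

/-- The vector field `v` is smooth on `U`. -/
def SmoothVectorFieldOn [IsManifold (𝓡 n) ∞ X] (U : Set X)
    (v : ∀ x : X, TangentSpace (𝓡 n) x) : Prop :=
  (SmoothVB.tangent n X).SmoothSectionOn U v

/-- Sections over the open set `U` of the sheaf of smooth vector fields preserving `I_Z`. -/
def logVectorFields [IsManifold (𝓡 n) ∞ X] (Z U : Set X)
    (v : ∀ x : X, TangentSpace (𝓡 n) x) : Prop :=
  SmoothVectorFieldOn U v ∧ ∀ W : Set X, IsOpen W → W ⊆ U → ∀ f : X → ℝ,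
    MemIdealPow n Z 1 W f → MemIdealPow n Z 1 W (lieDerivFun v f)

/-- Sections over the open set `U` of the sheaf of smooth vector fields `v` such that
`L_v f ∈ I_Z ^ k` for all `f` in the given jet. -/
def bkVectorFields [IsManifold (𝓡 n) ∞ X] {Z : Set X} (k : ℕ) {m : ℕ} (j : JetAlong n Z m)
    (U : Set X) (v : ∀ x : X, TangentSpace (𝓡 n) x) : Prop :=
  SmoothVectorFieldOn U v ∧ ∀ W : Set X, IsOpen W → W ⊆ U → ∀ f : X → ℝ,
    j.Represents W f → MemIdealPow n Z k W (lieDerivFun v f)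

/-- A smooth vector bundle whose sheaf of sections is the given subsheaf `V` of the sheaf of
vector fields: the anchor `A → TX` is a smooth bundle map that induces, over every open set `U`, a
bijection from the smooth sections of `A` onto `V(U)`. If `V` is closed under the Lie bracket,
this bijection carries the unique Lie algebroid structure on `A` with this anchor. -/
structure BundleOfVectorFields [IsManifold (𝓡 n) ∞ X]
    (V : Set X → (∀ x : X, TangentSpace (𝓡 n) x) → Prop) where
  bundle : SmoothVB n X
  anchor : ∀ x, bundle.E x →ₗ[ℝ] TangentSpace (𝓡 n) x
  anchor_smooth : ContMDiff ((𝓡 n).prod 𝓘(ℝ, bundle.F)) (𝓡 n).tangent ∞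
    (fun a : bundle.Total => (⟨a.1, anchor a.1 a.2⟩ : TangentBundle (𝓡 n) X))
  anchor_mem : ∀ U : Set X, IsOpen U → ∀ a : ∀ x, bundle.E x, bundle.SmoothSectionOn U a →
    V U (fun x => anchor x (a x))
  anchor_injective : ∀ U : Set X, IsOpen U → ∀ a : ∀ x, bundle.E x, bundle.SmoothSectionOn U a →
    (∀ x ∈ U, anchor x (a x) = 0) → ∀ x ∈ U, a x = 0
  anchor_surjective : ∀ U : Set X, IsOpen U → ∀ v : ∀ x : X, TangentSpace (𝓡 n) x, V U v →
    ∃ a : ∀ x, bundle.E x, bundle.SmoothSectionOn U a ∧ ∀ x ∈ U, anchor x (a x) = v x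

/-- The log-tangent bundle `A_Z = TX(-log Z)` with its anchor. -/
abbrev LogTangentBundle [IsManifold (𝓡 n) ∞ X] (Z : Set X) :=
  BundleOfVectorFields (logVectorFields (n := n) Z)

/-- The `b^k`-tangent bundle `A_Z^k` determined by a jet, with its anchor. -/
abbrev BkTangentBundle [IsManifold (𝓡 n) ∞ X] {Z : Set X} (k : ℕ) {m : ℕ}
    (j : JetAlong n Z m) :=
  BundleOfVectorFields (bkVectorFields k j)

end Germs

/-! ## Log divisors -/

/-- Two maps `f` and `g` into a manifold `N` are transverse: wherever `g y = f x`, the images of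
the two differentials span the tangent space of `N`. -/
def TransverseMaps {E₁ H₁ E₂ H₂ E₃ H₃ M M' N : Type*}
    [NormedAddCommGroup E₁] [NormedSpace ℝ E₁] [TopologicalSpace H₁] (I₁ : ModelWithCorners ℝ E₁ H₁)
    [NormedAddCommGroup E₂] [NormedSpace ℝ E₂] [TopologicalSpace H₂] (I₂ : ModelWithCorners ℝ E₂ H₂)
    [NormedAddCommGroup E₃] [NormedSpace ℝ E₃] [TopologicalSpace H₃] (I₃ : ModelWithCorners ℝ E₃ H₃)
    [TopologicalSpace M] [ChartedSpace H₁ M] [TopologicalSpace M'] [ChartedSpace H₂ M']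
    [TopologicalSpace N] [ChartedSpace H₃ N] (f : M → N) (g : M' → N) : Prop :=
  ∀ (x : M) (y : M') (h : g y = f x) (w : TangentSpace I₃ (f x)),
    ∃ (a : TangentSpace I₁ x) (b : TangentSpace I₂ y),
      w = mfderiv I₁ I₃ f x a + h ▸ mfderiv I₂ I₃ g y b

/-- A log divisor `(L, s)`: a real line bundle with a smooth section whose zero set is nowhere
dense, and which is transverse to the zero section. -/
structure LogDivisor (n : ℕ) (X : Type*) [TopologicalSpace X]
    [ChartedSpace (EuclideanSpace ℝ (Fin n)) X] where
  L : SmoothVB n X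
  rank_one : Module.finrank ℝ L.F = 1
  s : ∀ x, L.E x
  smooth : L.SmoothSectionOn univ s
  nowhereDense : IsNowhereDense {x | s x = 0}
  transverse : TransverseMaps (𝓡 n) (𝓡 n) ((𝓡 n).prod 𝓘(ℝ, L.F))
    (fun x => (⟨x, s x⟩ : L.Total)) (fun x => (⟨x, 0⟩ : L.Total))

/-- The zero locus of a log divisor. -/
def LogDivisor.zeroSet {n : ℕ} {X : Type*} [TopologicalSpace X]
    [ChartedSpace (EuclideanSpace ℝ (Fin n)) X] (D : LogDivisor n X) : Set X :=
  {x | D.s x = 0}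

end

/-!
Near a point of `Z` let `z` be a defining function representing the jet, and put `k = m + 1`. A
vector field `v` belongs to the `b^k`-tangent sheaf iff `dz(v)` is a multiple of `z ^ k`
(`bkVectorFields_iff`): another representative has the form `z + h z ^ k`, and Hadamard's lemma
(`IsLocalDefiningFunction.exists_eq_mul`) shows that membership in `I_Z ^ k` is divisibility by
`z ^ k`. The log-tangent sheaf is the case of the zero jet of order `0`
(`logVectorFields_eq_bkVectorFields`), so both parts of the theorem are the same statement, applied
in the first part to the line bundle `M = L` with its section `σ = s`, in the second to `M = L ^ k`
with `σ = s ^ k`. Transversality of `s` says that locally `σ = z ^ k ε` with a frame `ε` of `M`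
(`LogDivisor.exists_eq_smul`).

Along `Z` the form `dz ⊗ ε` with values in `M` depends neither on `z` nor on `ε`
(`IsLocalFactorization.dFun_smul_eq`), so a partition of unity yields a bundle map `α : TX → M`
which equals `dz ⊗ ε` along `Z` and takes fields of the `b^k`-tangent sheaf to multiples of `σ`
(`exists_linearMap_eq_dFun_smul`). The map `TX ⊕ ℝ → M`, `(v, f) ↦ α v + f σ`, is onto: along `Z`
because `dz ≠ 0`, elsewhere because `σ ≠ 0`. A section `(v, f)` lies in its kernel iff `v` belongs
to the `b^k`-tangent sheaf (`bkVectorFields_of_add_smul_eq_zero`) and `f` is the function, unique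
since `Z` is nowhere dense, with `α v = -f σ`. Hence the kernel is the `b^k`-tangent bundle, and a
splitting of the surjection gives the isomorphism (`nonempty_iso_of_isLocalFactorization`).

Existence of the bundles comes from one construction: local frames which are injective off `Z` and
have smooth transition functions determine a vector bundle (`FrameAtlas.bundle`). For the
`b^k`-tangent bundle the frames rescale the direction transverse to `Z` by `z ^ k`; for the line
bundle of a log divisor they are the functions `1 / z`.

A bundle of vector fields is only given through its sheaf of sections, so that bundle maps are built
from sections: `SmoothVB.nonempty_iso_of_correspondence` turns a fibrewise linear correspondence
matching the sections of two bundles into an isomorphism.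
-/

noncomputable section

/-! ### Hadamard's lemma -/

open MeasureTheory in
/-- A parametric integral over a compact interval is as smooth as its integrand. The derivative
takes its values in another space, so that the induction is over all target spaces `E` at once. -/
theorem contDiff_nat_intervalIntegral_of_contDiff {H : Type} [NormedAddCommGroup H]
    [NormedSpace ℝ H] [FiniteDimensional ℝ H] (a b : ℝ) (k : ℕ) :
    ∀ {E : Type} [NormedAddCommGroup E] [NormedSpace ℝ E] [CompleteSpace E] {f : H × ℝ → E},
      ContDiff ℝ k f → ContDiff ℝ k fun x => ∫ t in a..b, f (x, t) := by
  induction k with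
  | zero =>
    intro E _ _ _ f hf
    have hf' : Continuous f := hf.continuous
    exact contDiff_zero.2
      (intervalIntegral.continuous_parametric_intervalIntegral_of_continuous' (by fun_prop) a b)
  | succ k ih =>
    intro E _ _ _ f hf
    have hfk : ContDiff ℝ k fun p : H × ℝ =>
        (fderiv ℝ f p).comp (ContinuousLinearMap.inl ℝ H ℝ) := by
      have : ContDiff ℝ k (fderiv ℝ f) := hf.fderiv_right (by norm_cast)
      exact this.clm_comp contDiff_const
    have hd : Differentiable ℝ f := hf.differentiable (by simp)
    refine contDiff_succ_iff_hasFDerivAt.2 ⟨_, ih hfk, fun x₀ => ?_⟩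
    obtain ⟨s, hs, hsx⟩ := exists_compact_mem_nhds x₀
    obtain ⟨C, hC⟩ := (hs.prod isCompact_uIcc).exists_bound_of_continuousOn
      (f := fun p : H × ℝ => (fderiv ℝ f p).comp (ContinuousLinearMap.inl ℝ H ℝ))
      (s := s ×ˢ uIcc a b) hfk.continuous.continuousOn
    have hc : Continuous f := hf.continuous
    have hck := hfk.continuous
    refine intervalIntegral.hasFDerivAt_integral_of_dominated_of_fderiv_le (𝕜 := ℝ)
      (F := fun x t => f (x, t)) (bound := fun _ => C)
      (F' := fun x t => (fderiv ℝ f (x, t)).comp (ContinuousLinearMap.inl ℝ H ℝ))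
      hsx (.of_forall fun x => ?_) ?_ ?_ (.of_forall fun t ht x hx => ?_) ?_
      (.of_forall fun t ht x hx => ?_)
    · exact (hc.comp (by fun_prop)).aestronglyMeasurable
    · exact (hc.comp (by fun_prop)).intervalIntegrable _ _
    · exact (hck.comp (f := fun t => (x₀, t)) (by fun_prop)).aestronglyMeasurable
    · exact hC (x, t) ⟨hx, uIoc_subset_uIcc ht⟩
    · exact intervalIntegrable_const
    · exact (hd (x, t)).hasFDerivAt.comp x (hasFDerivAt_prodMk_left x t)

theorem contDiff_intervalIntegral_of_contDiff {H E : Type} [NormedAddCommGroup H]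
    [NormedSpace ℝ H] [FiniteDimensional ℝ H] [NormedAddCommGroup E] [NormedSpace ℝ E]
    [CompleteSpace E] (a b : ℝ) {f : H × ℝ → E} (hf : ContDiff ℝ ∞ f) :
    ContDiff ℝ ∞ fun x => ∫ t in a..b, f (x, t) :=
  contDiff_infty.2 fun k =>
    contDiff_nat_intervalIntegral_of_contDiff a b k (hf.of_le (by exact_mod_cast le_top))

/-- Hadamard's lemma for a hyperplane: integrate the derivative along the lines transverse to it. -/
theorem ContDiff.exists_eq_mul_of_eq_zero_of_ker {E : Type} [NormedAddCommGroup E]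
    [NormedSpace ℝ E] [FiniteDimensional ℝ E] {f : E → ℝ} (hf : ContDiff ℝ ∞ f) {l : E →L[ℝ] ℝ}
    {w : E} (hw : l w = 1) (h : ∀ x, l x = 0 → f x = 0) :
    ∃ g : E → ℝ, ContDiff ℝ ∞ g ∧ ∀ x, f x = g x * l x := by
  have hD : ContDiff ℝ ∞ fun x => fderiv ℝ f x w :=
    (hf.fderiv_right (m := ∞) (by simp)).clm_apply contDiff_const
  refine ⟨_, contDiff_intervalIntegral_of_contDiff 0 1
    (f := fun p : E × ℝ => fderiv ℝ f (p.1 + ((p.2 - 1) * l p.1) • w) w) (hD.comp (by fun_prop)),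
    fun x => ?_⟩
  have key : ∀ t : ℝ, HasDerivAt (fun t => f (x + ((t - 1) * l x) • w))
      (l x * fderiv ℝ f (x + ((t - 1) * l x) • w) w) t := by
    intro t
    have h1 : HasDerivAt (fun t : ℝ => x + ((t - 1) * l x) • w) (l x • w) t := by
      have := ((((hasDerivAt_id t).sub_const 1).mul_const (l x)).smul_const w).const_add x
      simpa using this
    have h2 := ((hf.differentiable (by simp)) (x + ((t - 1) * l x) • w)).hasFDerivAt.comp_hasDerivAt
      t h1
    rw [map_smul, smul_eq_mul] at h2
    exact h2
  have hint : Continuous fun t : ℝ => l x * fderiv ℝ f (x + ((t - 1) * l x) • w) w :=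
    continuous_const.mul (hD.continuous.comp (by fun_prop))
  have := intervalIntegral.integral_eq_sub_of_hasDerivAt (fun t _ => key t)
    (hint.intervalIntegrable 0 1)
  rw [intervalIntegral.integral_const_mul] at this
  have h0 : f (x + ((0 - 1) * l x) • w) = 0 := h _ (by simp [hw])
  rw [h0] at this
  simp only [sub_self, zero_mul, zero_smul, add_zero, sub_zero] at this
  rw [← this, mul_comm]

/-- Hadamard's lemma for a regular zero set: a local diffeomorphism turns `z` into a linear
form, so that the case of a hyperplane applies. -/
theorem ContDiffOn.exists_eq_mul_of_eq_zero {E : Type} [NormedAddCommGroup E]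
    [NormedSpace ℝ E] [FiniteDimensional ℝ E] {f z : E → ℝ} {U : Set E} (hU : IsOpen U) {x₀ : E}
    (hx₀ : x₀ ∈ U) (hf : ContDiffOn ℝ ∞ f U) (hz : ContDiffOn ℝ ∞ z U)
    (hdz : fderiv ℝ z x₀ ≠ 0) (h : ∀ x ∈ U, z x = 0 → f x = 0) :
    ∃ V : Set E, IsOpen V ∧ x₀ ∈ V ∧ V ⊆ U ∧ ∃ g : E → ℝ, ContDiffOn ℝ ∞ g V ∧
      ∀ x ∈ V, f x = g x * z x := by
  set l := fderiv ℝ z x₀ with hl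
  obtain ⟨w, hw⟩ : ∃ w, l w = 1 := by
    obtain ⟨v, hv⟩ : ∃ v, l v ≠ 0 := by
      by_contra! hc
      exact hdz (ContinuousLinearMap.ext hc)
    exact ⟨(l v)⁻¹ • v, by simp [hv]⟩
  -- moving `x` in the direction `w` by the nonlinear part of `z` gives `l ∘ ψ = z`
  let ψ : E → E := fun x => x + (z x - l x) • w
  have hψ : ContDiffOn ℝ ∞ ψ U := by fun_prop
  have hψat : ∀ x ∈ U, ContDiffAt ℝ ∞ ψ x := fun x hx => hψ.contDiffAt (hU.mem_nhds hx)
  have hlψ : ∀ x, l (ψ x) = z x := fun x => by simp [ψ, hw]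
  have hd₀ : HasFDerivAt ψ ((ContinuousLinearEquiv.refl ℝ E : E ≃L[ℝ] E) : E →L[ℝ] E) x₀ := by
    have h1 : HasFDerivAt z l x₀ :=
      ((hz.contDiffAt (hU.mem_nhds hx₀)).differentiableAt (by simp)).hasFDerivAt
    have := (hasFDerivAt_id (𝕜 := ℝ) x₀).add ((h1.sub l.hasFDerivAt).smul_const w)
    refine this.congr_fderiv ?_
    ext v
    simp
  let Ψ := (hψat x₀ hx₀).toOpenPartialHomeomorph ψ hd₀ (by simp)
  have hΨ : ∀ x, Ψ x = ψ x := fun x => rfl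
  have hx₀Ψ : x₀ ∈ Ψ.source := (hψat x₀ hx₀).mem_toOpenPartialHomeomorph_source hd₀ (by simp)
  -- the inverse is smooth near the image of `x₀`, where the differential remains invertible
  have hinv : ∀ᶠ x in 𝓝 x₀, ∃ e : E ≃L[ℝ] E, HasFDerivAt ψ (e : E →L[ℝ] E) x := by
    have hc : ContinuousAt (fderiv ℝ ψ) x₀ :=
      ((hψat x₀ hx₀).fderiv_right (m := 0) (by simp)).continuousAt
    have hr := ContinuousLinearEquiv.nhds (ContinuousLinearEquiv.refl ℝ E)
    rw [← hd₀.fderiv] at hr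
    filter_upwards [hc.eventually hr, hU.mem_nhds hx₀] with x hx hxU
    obtain ⟨e, he⟩ := hx
    exact ⟨e, he ▸ ((hψat x hxU).differentiableAt (by simp)).hasFDerivAt⟩
  have hsymm : ∀ᶠ y in 𝓝 (ψ x₀), y ∈ Ψ.target ∧ Ψ.symm y ∈ U ∧ ContDiffAt ℝ ∞ Ψ.symm y := by
    have ht : Ψ.target ∈ 𝓝 (ψ x₀) := Ψ.open_target.mem_nhds (Ψ.map_source hx₀Ψ)
    have hcs : Tendsto Ψ.symm (𝓝 (ψ x₀)) (𝓝 x₀) := by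
      have := Ψ.continuousAt_symm (Ψ.map_source hx₀Ψ)
      rw [ContinuousAt, Ψ.left_inv hx₀Ψ] at this
      exact this
    filter_upwards [ht, hcs.eventually hinv, hcs.eventually (hU.mem_nhds hx₀)] with y hy he hyU
    obtain ⟨e, he⟩ := he
    exact ⟨hy, hyU, Ψ.contDiffAt_symm hy he (hψat _ hyU)⟩
  obtain ⟨r, hr, hball⟩ := Metric.eventually_nhds_iff_ball.1 hsymm
  -- the case of a hyperplane needs a function on the whole space, hence the cut-off
  let χ : ContDiffBump (ψ x₀) := ⟨r / 4, r / 2, by linarith, by linarith⟩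
  have hχ : tsupport χ ⊆ Metric.ball (ψ x₀) r := by
    rw [χ.tsupport_eq]
    exact Metric.closedBall_subset_ball (by simp [χ]; linarith)
  have hF : ContDiff ℝ ∞ fun y => χ y * f (Ψ.symm y) := by
    rw [contDiff_iff_contDiffAt]
    intro y
    by_cases hy : y ∈ tsupport χ
    · obtain ⟨-, hyU, hys⟩ := hball y (hχ hy)
      exact χ.contDiffAt.mul ((hf.contDiffAt (hU.mem_nhds hyU)).comp y hys)
    · refine (contDiffAt_const (c := (0 : ℝ))).congr_of_eventuallyEq ?_
      filter_upwards [notMem_tsupport_iff_eventuallyEq.1 hy] with x hx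
      simp [hx]
  obtain ⟨g, hg, hfg⟩ := hF.exists_eq_mul_of_eq_zero_of_ker hw fun y hy => by
    by_cases hyχ : y ∈ tsupport χ
    · obtain ⟨hyt, hyU, -⟩ := hball y (hχ hyχ)
      have hzy : z (Ψ.symm y) = 0 := by
        rw [← hlψ, ← hΨ, Ψ.right_inv hyt, hy]
      rw [h _ hyU hzy, mul_zero]
    · rw [image_eq_zero_of_notMem_tsupport hyχ, zero_mul]
  have hV : IsOpen (Ψ.source ∩ Ψ ⁻¹' Metric.ball (ψ x₀) (r / 4)) :=
    Ψ.continuousOn.isOpen_inter_preimage Ψ.open_source Metric.isOpen_ball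
  refine ⟨Ψ.source ∩ Ψ ⁻¹' Metric.ball (ψ x₀) (r / 4) ∩ U, hV.inter hU,
    ⟨⟨hx₀Ψ, by simpa [hΨ] using hr⟩, hx₀⟩, inter_subset_right, fun x => g (ψ x),
    hg.comp_contDiffOn (hψ.mono inter_subset_right), ?_⟩
  rintro x ⟨⟨hxs, hxb⟩, hxU⟩
  have := hfg (ψ x)
  have hχx : χ (ψ x) = 1 := χ.one_of_mem_closedBall (Metric.ball_subset_closedBall hxb)
  have hΨx : Ψ.symm (ψ x) = x := Ψ.left_inv hxs
  rw [hlψ, hχx, one_mul, hΨx] at this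
  exact this

/-! ### Sections of smooth vector bundles -/

namespace SmoothVB

variable {n : ℕ} {X : Type*} [TopologicalSpace X] [ChartedSpace (EuclideanSpace ℝ (Fin n)) X]
  {A B : SmoothVB n X} {U W : Set X}

theorem SmoothSectionOn.mono {s : ∀ x, A.E x} (h : A.SmoothSectionOn U s) (hW : W ⊆ U) :
    A.SmoothSectionOn W s :=
  ContMDiffOn.mono h hW

theorem SmoothSectionOn.congr {s t : ∀ x, A.E x} (h : A.SmoothSectionOn U s)
    (hst : ∀ x ∈ U, t x = s x) : A.SmoothSectionOn U t :=
  ContMDiffOn.congr h fun x hx => by rw [hst x hx]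

theorem SmoothSectionOn.add {s t : ∀ x, A.E x} (hs : A.SmoothSectionOn U s)
    (ht : A.SmoothSectionOn U t) : A.SmoothSectionOn U fun x => s x + t x :=
  ContMDiffOn.add_section hs ht

theorem SmoothSectionOn.sub {s t : ∀ x, A.E x} (hs : A.SmoothSectionOn U s)
    (ht : A.SmoothSectionOn U t) : A.SmoothSectionOn U fun x => s x - t x :=
  ContMDiffOn.sub_section hs ht

theorem SmoothSectionOn.smul {f : X → ℝ} {s : ∀ x, A.E x} (hf : ContMDiffOn (𝓡 n) 𝓘(ℝ, ℝ) ∞ f U)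
    (hs : A.SmoothSectionOn U s) : A.SmoothSectionOn U fun x => f x • s x :=
  ContMDiffOn.smul_section hf hs

theorem SmoothSectionOn.sum {ι : Type*} {S : Finset ι} {s : ι → ∀ x, A.E x}
    (hs : ∀ i ∈ S, A.SmoothSectionOn U (s i)) : A.SmoothSectionOn U fun x => ∑ i ∈ S, s i x :=
  ContMDiffOn.sum_section hs

theorem smoothSectionOn_zero : A.SmoothSectionOn U fun _ => 0 :=
  (contMDiff_zeroSection ℝ A.E).contMDiffOn

theorem smoothSectionOn_of_forall_exists {s : ∀ x, A.E x}
    (h : ∀ x ∈ U, ∃ W, IsOpen W ∧ x ∈ W ∧ A.SmoothSectionOn (U ∩ W) s) :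
    A.SmoothSectionOn U s :=
  contMDiffOn_of_locally_contMDiffOn h

/-- A section over a set contained in the domain of a trivialization `e` is smooth iff it is
smooth when read in `e`. -/
theorem smoothSectionOn_iff {s : ∀ x, A.E x} (hU : IsOpen U)
    (e : Trivialization A.F (TotalSpace.proj : A.Total → X)) [MemTrivializationAtlas e]
    (he : U ⊆ e.baseSet) :
    A.SmoothSectionOn U s ↔ ContMDiffOn (𝓡 n) 𝓘(ℝ, A.F) ∞ (fun x => (e ⟨x, s x⟩).2) U :=
  e.contMDiffOn_section_iff hU he

theorem smoothSectionOn_symm (e : Trivialization A.F (TotalSpace.proj : A.Total → X))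
    [MemTrivializationAtlas e] (hU : IsOpen U) (he : U ⊆ e.baseSet) {f : X → A.F}
    (hf : ContMDiffOn (𝓡 n) 𝓘(ℝ, A.F) ∞ f U) :
    A.SmoothSectionOn U fun x => e.symm x (f x) := by
  rw [smoothSectionOn_iff hU e he]
  exact hf.congr fun x hx => by simp [e.apply_mk_symm (he hx)]

theorem smoothSectionOn_trivialLine {f : X → ℝ} :
    (trivialLine n X).SmoothSectionOn U f ↔ ContMDiffOn (𝓡 n) 𝓘(ℝ, ℝ) ∞ f U := by
  refine forall₂_congr fun x _ => ?_
  exact contMDiffWithinAt_section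

/-- A frame of a smooth vector bundle over `U`, together with its coefficient functionals, which are
smooth both on sections and on the total space. -/
structure Frame (A : SmoothVB n X) (U : Set X) where
  rank : ℕ
  sec : Fin rank → ∀ x, A.E x
  coeff : Fin rank → ∀ x, A.E x →ₗ[ℝ] ℝ
  smooth_sec : ∀ i, A.SmoothSectionOn U (sec i)
  smooth_coeff : ∀ i (W : Set X), IsOpen W → W ⊆ U → ∀ s, A.SmoothSectionOn W s →
    ContMDiffOn (𝓡 n) 𝓘(ℝ, ℝ) ∞ (fun x => coeff i x (s x)) W
  smooth_coeff_total : ∀ i, ContMDiffOn ((𝓡 n).prod 𝓘(ℝ, A.F)) 𝓘(ℝ, ℝ) ∞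
    (fun a : A.Total => coeff i a.1 a.2) (TotalSpace.proj ⁻¹' U)
  sum_eq : ∀ x ∈ U, ∀ a, ∑ i, coeff i x a • sec i x = a

theorem exists_frame (A : SmoothVB n X) (p : X) :
    ∃ U : Set X, IsOpen U ∧ p ∈ U ∧ Nonempty (A.Frame U) := by
  let e := trivializationAt A.F A.E p
  let b := Module.finBasis ℝ A.F
  have htot : ∀ i, ContMDiffOn ((𝓡 n).prod 𝓘(ℝ, A.F)) 𝓘(ℝ, ℝ) ∞
      (fun a : A.Total => b.coord i (e a).2) (TotalSpace.proj ⁻¹' e.baseSet) := fun i => by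
    have h1 : ContMDiffOn ((𝓡 n).prod 𝓘(ℝ, A.F)) 𝓘(ℝ, A.F) ∞
        (fun a : A.Total => (e a).2) (TotalSpace.proj ⁻¹' e.baseSet) := by
      have := e.contMDiffOn (IB := 𝓡 n) (n := ∞)
      rw [e.source_eq] at this
      exact contMDiff_snd.comp_contMDiffOn this
    exact (LinearMap.toContinuousLinearMap (b.coord i)).contMDiff.comp_contMDiffOn h1
  refine ⟨e.baseSet, e.open_baseSet, FiberBundle.mem_baseSet_trivializationAt' p, ⟨?_⟩⟩
  refine
  { rank := Module.finrank ℝ A.F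
    sec := fun i x => e.symm x (b i)
    coeff := fun i x => (b.coord i).comp (e.linearMapAt ℝ x)
    smooth_sec := fun i => smoothSectionOn_symm e e.open_baseSet subset_rfl contMDiffOn_const
    smooth_coeff_total := fun i => (htot i).congr fun a ha => ?_
    smooth_coeff := fun i W hW hWU s hs => ?_
    sum_eq := fun x hx a => ?_ }
  · have := (smoothSectionOn_iff hW e hWU).1 hs
    refine ((LinearMap.toContinuousLinearMap (b.coord i)).contMDiff.comp_contMDiffOn this).congr
      fun x hx => ?_
    simp [hWU hx]
  · have ha' : a.1 ∈ e.baseSet := ha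
    simp [ha']
  · have h1 : ∀ i, e.symm x (b i) = e.symmₗ ℝ x (b i) := fun i => (e.symmₗ_apply hx _).symm
    simp only [h1, LinearMap.comp_apply, Module.Basis.coord_apply, ← map_smul]
    rw [← map_sum, b.sum_repr, e.symmₗ_linearMapAt hx]

theorem exists_section (A : SmoothVB n X) (p : X) (a : A.E p) :
    ∃ U : Set X, IsOpen U ∧ p ∈ U ∧ ∃ s, A.SmoothSectionOn U s ∧ s p = a := by
  obtain ⟨U, hU, hp, ⟨Φ⟩⟩ := A.exists_frame p
  exact ⟨U, hU, hp, fun x => ∑ i, Φ.coeff i p a • Φ.sec i x,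
    SmoothSectionOn.sum fun i _ => SmoothSectionOn.smul contMDiffOn_const (Φ.smooth_sec i),
    Φ.sum_eq p hp a⟩

/-- A fibrewise linear map of smooth vector bundles which takes smooth local sections to smooth
local sections is smooth as a map of total spaces. -/
theorem contMDiff_total_of_sections (T : ∀ x, A.E x →ₗ[ℝ] B.E x)
    (hT : ∀ U : Set X, IsOpen U → ∀ a : ∀ x, A.E x, A.SmoothSectionOn U a → ∀ x ∈ U,
      ∃ W, IsOpen W ∧ x ∈ W ∧ B.SmoothSectionOn W fun x => T x (a x)) :
    ContMDiff ((𝓡 n).prod 𝓘(ℝ, A.F)) ((𝓡 n).prod 𝓘(ℝ, B.F)) ∞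
      (fun a : A.Total => (⟨a.1, T a.1 a.2⟩ : B.Total)) := by
  intro a₀
  obtain ⟨U, hU, ha₀, ⟨Φ⟩⟩ := A.exists_frame a₀.1
  let e := trivializationAt B.F B.E a₀.1
  have he₀ : a₀.1 ∈ e.baseSet := FiberBundle.mem_baseSet_trivializationAt' a₀.1
  choose W hW ha₀W hTW using fun i => hT U hU _ (Φ.smooth_sec i) a₀.1 ha₀
  refine contMDiffAt_totalSpace.2 ⟨contMDiffAt_proj A.E, ?_⟩
  have hcoord : ∀ i, ContMDiffAt ((𝓡 n).prod 𝓘(ℝ, A.F)) 𝓘(ℝ, B.F) ∞ (fun a : A.Total =>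
      Φ.coeff i a.1 a.2 • (e ⟨a.1, T a.1 (Φ.sec i a.1)⟩).2) a₀ := fun i => by
    refine ContMDiffAt.smul ((Φ.smooth_coeff_total i).contMDiffAt
      ((hU.preimage (FiberBundle.continuous_proj A.F A.E)).mem_nhds ha₀)) ?_
    have h1 := (e.contMDiffAt_section_iff he₀).1 ((hTW i).contMDiffAt ((hW i).mem_nhds (ha₀W i)))
    exact ContMDiffAt.comp (g := fun x => (e ⟨x, T x (Φ.sec i x)⟩).2) a₀ h1 (contMDiffAt_proj A.E)
  have hsum := ContMDiffAt.sum (t := Finset.univ) fun i (_ : i ∈ Finset.univ) => hcoord i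
  refine hsum.congr_of_eventuallyEq ?_
  filter_upwards [((hU.inter e.open_baseSet).preimage
    (FiberBundle.continuous_proj A.F A.E)).mem_nhds ⟨ha₀, he₀⟩] with a ha
  have hlin : ∀ v, (e ⟨a.1, v⟩).2 = e.linearMapAt ℝ a.1 v := fun v => by
    rw [e.linearMapAt_apply, if_pos ha.2]
  change (e ⟨a.1, T a.1 a.2⟩).2 = _
  simp only [hlin, ← map_smul, ← map_sum]
  rw [Φ.sum_eq a.1 ha.1]

/-- A fibrewise linear correspondence which relates every section of `A` to one of `B`, and relates
the zero section of `A` only to that of `B`, is induced by a fibrewise linear map: on each fibre,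
extend vectors by means of a frame. -/
theorem exists_linearMap_of_correspondence (P : ∀ x, Submodule ℝ (A.E x × B.E x))
    (hAB : ∀ U : Set X, IsOpen U → ∀ a, A.SmoothSectionOn U a →
      ∃ b, B.SmoothSectionOn U b ∧ ∀ x ∈ U, (a x, b x) ∈ P x)
    (hB : ∀ U : Set X, IsOpen U → ∀ b, B.SmoothSectionOn U b → (∀ x ∈ U, (0, b x) ∈ P x) →
      ∀ x ∈ U, b x = 0) :
    ∃ T : ∀ x, A.E x →ₗ[ℝ] B.E x, ∀ U : Set X, IsOpen U → ∀ a, A.SmoothSectionOn U a →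
      ∀ b, B.SmoothSectionOn U b → (∀ x ∈ U, (a x, b x) ∈ P x) → ∀ x ∈ U, T x (a x) = b x := by
  choose V hV hpV hΦ using A.exists_frame
  let Φ := fun p => (hΦ p).some
  choose β hβ hβP using fun p i => hAB (V p) (hV p) _ ((Φ p).smooth_sec i)
  refine ⟨fun p => ∑ i, ((Φ p).coeff i p).smulRight (β p i p), fun U hU a ha b hb hab x hx => ?_⟩
  have hsub₁ : U ∩ V x ⊆ U := inter_subset_left
  have hsub₂ : U ∩ V x ⊆ V x := inter_subset_right
  have hopen := hU.inter (hV x)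
  have hsum : B.SmoothSectionOn (U ∩ V x) fun y => ∑ i, (Φ x).coeff i y (a y) • β x i y :=
    SmoothSectionOn.sum fun i _ => SmoothSectionOn.smul
      ((Φ x).smooth_coeff i _ hopen hsub₂ _ (ha.mono hsub₁)) ((hβ x i).mono hsub₂)
  have h0 := hB _ hopen _ ((hb.mono hsub₁).sub hsum) (fun y hy => ?_) x ⟨hx, hpV x⟩
  · simpa using (sub_eq_zero.1 h0).symm
  · have h1 : (a y, ∑ i, (Φ x).coeff i y (a y) • β x i y) ∈ P y := by
      have h2 := Submodule.sum_mem (P y) (t := Finset.univ) fun i (_ : i ∈ Finset.univ) =>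
        (P y).smul_mem ((Φ x).coeff i y (a y)) (hβP x i y hy.2)
      rwa [Finset.sum_congr rfl fun i _ => Prod.smul_mk _ _ _, ← prod_mk_sum,
        (Φ x).sum_eq y hy.2 (a y)] at h2
    simpa using (P y).sub_mem (hab y hy.1) h1

/-- Two smooth vector bundles are isomorphic as soon as their sheaves of sections are matched
by a fibrewise linear correspondence. -/
theorem nonempty_iso_of_correspondence (P : ∀ x, Submodule ℝ (A.E x × B.E x))
    (hAB : ∀ U : Set X, IsOpen U → ∀ a, A.SmoothSectionOn U a →
      ∃ b, B.SmoothSectionOn U b ∧ ∀ x ∈ U, (a x, b x) ∈ P x)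
    (hBA : ∀ U : Set X, IsOpen U → ∀ b, B.SmoothSectionOn U b →
      ∃ a, A.SmoothSectionOn U a ∧ ∀ x ∈ U, (a x, b x) ∈ P x)
    (hA : ∀ U : Set X, IsOpen U → ∀ a, A.SmoothSectionOn U a → (∀ x ∈ U, (a x, 0) ∈ P x) →
      ∀ x ∈ U, a x = 0)
    (hB : ∀ U : Set X, IsOpen U → ∀ b, B.SmoothSectionOn U b → (∀ x ∈ U, (0, b x) ∈ P x) →
      ∀ x ∈ U, b x = 0) :
    Nonempty (A.Iso B) := by
  obtain ⟨T, hT⟩ := exists_linearMap_of_correspondence P hAB hB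
  obtain ⟨S, hS⟩ := exists_linearMap_of_correspondence
    (fun x => (P x).comap (LinearEquiv.prodComm ℝ (B.E x) (A.E x)).toLinearMap) hBA hA
  have hST : ∀ x a, S x (T x a) = a := fun x a => by
    obtain ⟨U, hU, hx, s, hs, rfl⟩ := A.exists_section x a
    obtain ⟨b, hb, hsb⟩ := hAB U hU s hs
    rw [hT U hU s hs b hb hsb x hx]
    exact hS U hU b hb s hs hsb x hx
  have hTS : ∀ x b, T x (S x b) = b := fun x b => by
    obtain ⟨U, hU, hx, s, hs, rfl⟩ := B.exists_section x b
    obtain ⟨a, ha, hsa⟩ := hBA U hU s hs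
    rw [hS U hU s hs a ha hsa x hx]
    exact hT U hU a ha s hs hsa x hx
  refine ⟨⟨fun x => LinearEquiv.ofLinearMap (T x) (S x) (LinearMap.ext (hTS x))
    (LinearMap.ext (hST x)), ?_, ?_⟩⟩
  · refine contMDiff_total_of_sections T fun U hU a ha x hx => ?_
    obtain ⟨b, hb, hab⟩ := hAB U hU a ha
    exact ⟨U, hU, hx, hb.congr (hT U hU a ha b hb hab)⟩
  · refine contMDiff_total_of_sections S fun U hU b hb x hx => ?_
    obtain ⟨a, ha, hab⟩ := hBA U hU b hb
    exact ⟨U, hU, hx, ha.congr (hS U hU b hb a ha hab)⟩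

end SmoothVB

/-! ### Identities on a dense set -/

theorem ContinuousOn.eqOn_of_dense {X Y : Type*} [TopologicalSpace X] [TopologicalSpace Y]
    [T2Space Y] {U D : Set X} {f g : X → Y} (hf : ContinuousOn f U) (hg : ContinuousOn g U)
    (hU : IsOpen U) (hD : Dense D) (h : ∀ x ∈ U, x ∈ D → f x = g x) : ∀ x ∈ U, f x = g x :=
  EqOn.of_subset_closure (s := U ∩ D) (fun x hx => h x hx.1 hx.2) hf hg inter_subset_left
    (hD.open_subset_closure_inter hU)

namespace SmoothVB

variable {n : ℕ} {X : Type*} [TopologicalSpace X] [ChartedSpace (EuclideanSpace ℝ (Fin n)) X]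
  {A B : SmoothVB n X} {U W : Set X}

theorem SmoothSectionOn.eq_zero_of_dense {D : Set X} {s : ∀ x, A.E x} (hs : A.SmoothSectionOn U s)
    (hU : IsOpen U) (hD : Dense D) (h : ∀ x ∈ U, x ∈ D → s x = 0) : ∀ x ∈ U, s x = 0 := by
  intro p hp
  obtain ⟨V, hV, hpV, ⟨Φ⟩⟩ := A.exists_frame p
  have key : ∀ i, Φ.coeff i p (s p) = 0 := fun i =>
    (Φ.smooth_coeff i (U ∩ V) (hU.inter hV) inter_subset_right s
      (hs.mono inter_subset_left)).continuousOn.eqOn_of_dense continuousOn_const (hU.inter hV) hD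
      (fun x hx hxD => by rw [h x hx.1 hxD, map_zero]) p ⟨hp, hpV⟩
  rw [← Φ.sum_eq p hpV (s p)]
  exact Finset.sum_eq_zero fun i _ => by rw [key, zero_smul]

theorem SmoothSectionOn.eq_of_dense {D : Set X} {s t : ∀ x, A.E x} (hs : A.SmoothSectionOn U s)
    (ht : A.SmoothSectionOn U t) (hU : IsOpen U) (hD : Dense D)
    (h : ∀ x ∈ U, x ∈ D → s x = t x) : ∀ x ∈ U, s x = t x := fun x hx =>
  sub_eq_zero.1 <| (hs.sub ht).eq_zero_of_dense hU hD
    (fun y hy hyD => sub_eq_zero.2 (h y hy hyD)) x hx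

/-- Division of a section by a function with nowhere dense zero set is a local problem, because
the quotient is unique. -/
theorem exists_smul_eq_of_locally {D : Set X} (hD : Dense D) (hU : IsOpen U) {f : X → ℝ}
    (hf : ∀ x ∈ U, x ∈ D → f x ≠ 0) {s : ∀ x, A.E x}
    (h : ∀ p ∈ U, ∃ W, IsOpen W ∧ p ∈ W ∧ ∃ g, A.SmoothSectionOn W g ∧ ∀ x ∈ W, f x • g x = s x) :
    ∃ g, A.SmoothSectionOn U g ∧ ∀ x ∈ U, f x • g x = s x := by
  classical
  choose! W hW hpW g hg hgs using h
  have key : ∀ p ∈ U, ∀ q ∈ U, q ∈ W p → g q q = g p q := fun p hp q hq hqp => by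
    refine SmoothSectionOn.eq_of_dense (U := U ∩ (W p ∩ W q)) ((hg q hq).mono ?_)
      ((hg p hp).mono ?_) (hU.inter ((hW p hp).inter (hW q hq))) hD (fun x hx hxD => ?_) q
      ⟨hq, hqp, hpW q hq⟩
    · exact fun x hx => hx.2.2
    · exact fun x hx => hx.2.1
    · refine smul_right_injective _ (hf x hx.1 hxD) ?_
      exact (hgs q hq x hx.2.2).trans (hgs p hp x hx.2.1).symm
  refine ⟨fun x => g x x, smoothSectionOn_of_forall_exists fun p hp =>
    ⟨W p, hW p hp, hpW p hp, ?_⟩, fun x hx => hgs x hx x (hpW x hx)⟩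
  exact ((hg p hp).mono inter_subset_right).congr fun x hx => key p hp x hx.1 hx.2

theorem _root_.ContMDiffOn.exists_mul_eq_of_locally {D : Set X} (hD : Dense D) (hU : IsOpen U)
    {f s : X → ℝ} (hf : ∀ x ∈ U, x ∈ D → f x ≠ 0)
    (h : ∀ p ∈ U, ∃ W, IsOpen W ∧ p ∈ W ∧ ∃ g : X → ℝ, ContMDiffOn (𝓡 n) 𝓘(ℝ, ℝ) ∞ g W ∧
      ∀ x ∈ W, s x = g x * f x) :
    ∃ g : X → ℝ, ContMDiffOn (𝓡 n) 𝓘(ℝ, ℝ) ∞ g U ∧ ∀ x ∈ U, s x = g x * f x := by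
  obtain ⟨g, hg, hgs⟩ := exists_smul_eq_of_locally (A := trivialLine n X) (s := s) hD hU hf
    fun p hp => by
      obtain ⟨W, hW, hpW, g, hg, hgs⟩ := h p hp
      exact ⟨W, hW, hpW, g, smoothSectionOn_trivialLine.2 hg, fun x hx => by
        rw [hgs x hx]; exact mul_comm _ _⟩
  exact ⟨g, smoothSectionOn_trivialLine.1 hg, fun x hx => by
    rw [← hgs x hx]; exact mul_comm _ _⟩

theorem smoothSectionOn_sum {s : ∀ x, (A.sum B).E x} :
    (A.sum B).SmoothSectionOn U s ↔
      A.SmoothSectionOn U (fun x => (s x).1) ∧ B.SmoothSectionOn U (fun x => (s x).2) := by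
  simp only [SmoothSectionOn, ContMDiffOn, ← forall_and]
  refine forall₂_congr fun x _ => ?_
  rw [contMDiffWithinAt_section, contMDiffWithinAt_section, contMDiffWithinAt_section]
  exact contMDiffWithinAt_prod_module_iff _

/-- Local sections glued by a partition of unity form a smooth section. -/
theorem smoothSectionOn_finsum_partition {ι : Type*}
    {ρ : SmoothPartitionOfUnity ι (𝓡 n) X univ} {V : ι → Set X} (hV : ∀ i, IsOpen (V i))
    (hρ : ρ.IsSubordinate V) (hU : IsOpen U) {s : ι → ∀ x, A.E x}
    (hs : ∀ i, A.SmoothSectionOn (U ∩ V i) (s i)) :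
    A.SmoothSectionOn U fun x => ∑ᶠ i, ρ i x • s i x := by
  refine ContMDiffOn.finsum_section_of_locallyFinite (ρ.locallyFinite.subset fun i x hx => ?_)
    fun i x hx => ?_
  · exact fun h0 => hx (by simp [h0])
  · by_cases hxs : x ∈ tsupport (ρ i)
    · have h1 := SmoothSectionOn.smul (ρ i).contMDiff.contMDiffOn (hs i)
      exact (h1.contMDiffAt ((hU.inter (hV i)).mem_nhds ⟨hx, hρ i hxs⟩)).contMDiffWithinAt
    · refine (ContMDiffAt.congr_of_eventuallyEq (contMDiffAt_zeroSection ℝ A.E)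
        ?_).contMDiffWithinAt
      filter_upwards [notMem_tsupport_iff_eventuallyEq.1 hxs] with y hy
      simp [hy, zeroSection]

/-! ### Line bundles -/

theorem finrank_fibre (A : SmoothVB n X) (x : X) :
    Module.finrank ℝ (A.E x) = Module.finrank ℝ A.F :=
  (VectorBundle.continuousLinearEquivAt ℝ A.F A.E x).toLinearEquiv.finrank_eq

/-- The functional `m ↦ m / e` on a fibre of a line bundle, for a nonzero vector `e`; it is `0` for
`e = 0`. -/
def lineCoeff {x : X} (hA : Module.finrank ℝ A.F = 1) (e : A.E x) : A.E x →ₗ[ℝ] ℝ :=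
  open Classical in
  if he : e ≠ 0 then
    (FiniteDimensional.basisSingleton Unit ((A.finrank_fibre x).trans hA) e he).coord ()
  else 0

theorem lineCoeff_smul {x : X} (hA : Module.finrank ℝ A.F = 1) {e : A.E x} (he : e ≠ 0)
    (m : A.E x) : lineCoeff hA e m • e = m := by
  have := (FiniteDimensional.basisSingleton Unit ((A.finrank_fibre x).trans hA) e he).sum_repr m
  simpa [lineCoeff, he] using this

theorem SmoothSectionOn.lineCoeff (hA : Module.finrank ℝ A.F = 1) {e m : ∀ x, A.E x}
    (hU : IsOpen U) (he : A.SmoothSectionOn U e) (hm : A.SmoothSectionOn U m)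
    (he₀ : ∀ x ∈ U, e x ≠ 0) :
    ContMDiffOn (𝓡 n) 𝓘(ℝ, ℝ) ∞ (fun x => lineCoeff hA (e x) (m x)) U := by
  intro p hp
  obtain ⟨V, hV, hpV, ⟨Φ⟩⟩ := A.exists_frame p
  obtain ⟨i, hi⟩ : ∃ i, Φ.coeff i p (e p) ≠ 0 := by
    by_contra! hc
    exact he₀ p hp (by rw [← Φ.sum_eq p hpV (e p)]; simp [hc])
  have hUV := hU.inter hV
  have h1 := Φ.smooth_coeff i _ hUV inter_subset_right e (he.mono inter_subset_left)
  have h2 := Φ.smooth_coeff i _ hUV inter_subset_right m (hm.mono inter_subset_left)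
  have hn := hUV.mem_nhds ⟨hp, hpV⟩
  have hc := (h1.continuousOn.continuousAt hn).eventually_ne hi
  refine (ContMDiffAt.congr_of_eventuallyEq ((h2.contMDiffAt hn).div₀ (h1.contMDiffAt hn) hi)
    ?_).contMDiffWithinAt
  filter_upwards [hc, hn] with x hx hxU
  rw [Pi.div_apply, eq_div_iff hx]
  conv_rhs => rw [← lineCoeff_smul hA (he₀ x hxU.1) (m x), map_smul, smul_eq_mul]

end SmoothVB

/-! ### Lie derivatives of functions -/

section LieDeriv

variable {n : ℕ} {X : Type*} [TopologicalSpace X] [ChartedSpace (EuclideanSpace ℝ (Fin n)) X]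
  {U : Set X} {v : ∀ x : X, TangentSpace (𝓡 n) x}

theorem lieDerivFun_add {f g : X → ℝ} {x : X} (hf : ContMDiffAt (𝓡 n) 𝓘(ℝ, ℝ) ∞ f x)
    (hg : ContMDiffAt (𝓡 n) 𝓘(ℝ, ℝ) ∞ g x) :
    lieDerivFun v (fun y => f y + g y) x = lieDerivFun v f x + lieDerivFun v g x := by
  have h := (hf.mdifferentiableAt (by simp)).hasMFDerivAt.add
    (hg.mdifferentiableAt (by simp)).hasMFDerivAt
  exact congrArg (fun T => T (v x)) h.mfderiv

theorem lieDerivFun_mul {f g : X → ℝ} {x : X} (hf : ContMDiffAt (𝓡 n) 𝓘(ℝ, ℝ) ∞ f x)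
    (hg : ContMDiffAt (𝓡 n) 𝓘(ℝ, ℝ) ∞ g x) :
    lieDerivFun v (fun y => f y * g y) x = f x * lieDerivFun v g x + g x * lieDerivFun v f x := by
  have h := (hf.mdifferentiableAt (by simp)).hasMFDerivAt.mul
    (hg.mdifferentiableAt (by simp)).hasMFDerivAt
  exact congrArg (fun T => T (v x)) h.mfderiv

theorem lieDerivFun_pow_succ {f : X → ℝ} {x : X} (hf : ContMDiffAt (𝓡 n) 𝓘(ℝ, ℝ) ∞ f x) (m : ℕ) :
    lieDerivFun v (fun y => f y ^ (m + 1)) x = (m + 1) * f x ^ m * lieDerivFun v f x := by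
  induction m with
  | zero => simp
  | succ m ih =>
    simp only [pow_succ _ (m + 1)]
    rw [lieDerivFun_mul (hf.pow (m + 1)) hf, ih]
    push_cast
    ring

theorem lieDerivFun_congr {f g : X → ℝ} {x : X} (h : f =ᶠ[𝓝 x] g) :
    lieDerivFun v f x = lieDerivFun v g x := by
  simp only [lieDerivFun]
  rw [h.mfderiv_eq]
  rfl

theorem ContMDiffOn.lieDerivFun [IsManifold (𝓡 n) ∞ X] (hU : IsOpen U) {f : X → ℝ}
    (hf : ContMDiffOn (𝓡 n) 𝓘(ℝ, ℝ) ∞ f U) (hv : SmoothVectorFieldOn U v) :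
    ContMDiffOn (𝓡 n) 𝓘(ℝ, ℝ) ∞ (lieDerivFun v f) U := by
  have : IsManifold (𝓡 n) 1 X := IsManifold.of_le (n := ∞) (by simp)
  have h1 := hf.contMDiffOn_tangentMapWithin (m := ∞) (by simp) hU.uniqueMDiffOn
  have h2 := h1.comp hv fun x hx => hx
  have h3 := (contMDiff_snd_tangentBundle_modelSpace ℝ 𝓘(ℝ, ℝ)).comp_contMDiffOn h2
  refine h3.congr fun x hx => ?_
  simp only [_root_.lieDerivFun, Function.comp, tangentMapWithin, mfderivWithin_of_isOpen hU hx]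
  rfl

end LieDeriv

/-! ### Division by a local defining function -/

section Hypersurface

variable {n : ℕ} {X : Type*} [TopologicalSpace X] [ChartedSpace (EuclideanSpace ℝ (Fin n)) X]
  {Z U W : Set X} {z : X → ℝ}

theorem IsLocalDefiningFunction.mono (h : IsLocalDefiningFunction n Z U z) (hW : W ⊆ U) :
    IsLocalDefiningFunction n Z W z :=
  ⟨h.smooth.mono hW, fun x hx => h.zero_iff x (hW hx), fun x hx => h.mfderiv_ne_zero x (hW hx)⟩

theorem IsLocalDefiningFunction.ne_zero (h : IsLocalDefiningFunction n Z U z) {x : X}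
    (hx : x ∈ U) (hxZ : x ∉ Z) : z x ≠ 0 :=
  fun h0 => hxZ ((h.zero_iff x hx).1 h0)

/-- Away from `Z` the constant function `1` serves as defining function, so that many arguments need
no separate case there. -/
theorem isLocalDefiningFunction_one : IsLocalDefiningFunction n Z Zᶜ fun _ => 1 :=
  ⟨contMDiffOn_const, fun _ hx => ⟨fun h => absurd h one_ne_zero, fun h => absurd h hx⟩,
    fun _ hx hxZ => absurd hxZ hx⟩

theorem IsHypersurface.dense_compl (hZ : IsHypersurface n Z) : Dense Zᶜ := by
  rw [← interior_eq_empty_iff_dense_compl, eq_empty_iff_forall_notMem]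
  intro p hp
  obtain ⟨U, hU, hpU, z, hz⟩ := hZ.locally_defined p (interior_subset hp)
  refine hz.mfderiv_ne_zero p hpU (interior_subset hp) ?_
  have : z =ᶠ[𝓝 p] fun _ => 0 := by
    filter_upwards [hU.mem_nhds hpU, isOpen_interior.mem_nhds hp] with x hx hxZ
    exact (hz.zero_iff x hx).2 (interior_subset hxZ)
  rw [this.mfderiv_eq]
  exact mfderiv_const

/-- Hadamard's lemma on a manifold: a smooth function vanishing on `Z` is a smooth multiple of
a local defining function of `Z`. -/
theorem IsLocalDefiningFunction.exists_eq_mul [IsManifold (𝓡 n) ∞ X] (hZ : IsHypersurface n Z)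
    (hU : IsOpen U) (hz : IsLocalDefiningFunction n Z U z) {f : X → ℝ}
    (hf : ContMDiffOn (𝓡 n) 𝓘(ℝ, ℝ) ∞ f U) (hfZ : ∀ x ∈ U, x ∈ Z → f x = 0) :
    ∃ g : X → ℝ, ContMDiffOn (𝓡 n) 𝓘(ℝ, ℝ) ∞ g U ∧ ∀ x ∈ U, f x = g x * z x := by
  refine ContMDiffOn.exists_mul_eq_of_locally hZ.dense_compl hU (fun x hx => hz.ne_zero hx)
    fun p hp => ?_
  by_cases hpZ : p ∈ Z
  · let φ := extChartAt (𝓡 n) p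
    have hφ : ContMDiffOn (𝓡 n) 𝓘(ℝ, EuclideanSpace ℝ (Fin n)) ∞ φ φ.source := by
      have := contMDiffOn_extChartAt (I := 𝓡 n) (n := ∞) (x := p)
      rwa [← extChartAt_source (𝓡 n)] at this
    have hφs : ContMDiffOn 𝓘(ℝ, EuclideanSpace ℝ (Fin n)) (𝓡 n) ∞ φ.symm φ.target :=
      contMDiffOn_extChartAt_symm p
    have hpφ : p ∈ φ.source := mem_extChartAt_source p
    have hU' : IsOpen (φ.target ∩ φ.symm ⁻¹' U) :=
      (continuousOn_extChartAt_symm p).isOpen_inter_preimage (isOpen_extChartAt_target p) hU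
    have hcomp : ∀ {g : X → ℝ}, ContMDiffOn (𝓡 n) 𝓘(ℝ, ℝ) ∞ g U →
        ContDiffOn ℝ ∞ (g ∘ φ.symm) (φ.target ∩ φ.symm ⁻¹' U) := fun hg =>
      contMDiffOn_iff_contDiffOn.1
        (hg.comp (hφs.mono inter_subset_left) fun y hy => hy.2)
    have hd : fderiv ℝ (z ∘ φ.symm) (φ p) ≠ 0 := by
      have h1 := hz.mfderiv_ne_zero p hp hpZ
      have h2 : MDifferentiableAt (𝓡 n) 𝓘(ℝ, ℝ) z p :=
        (hz.smooth.contMDiffAt (hU.mem_nhds hp)).mdifferentiableAt (by simp)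
      rw [h2.mfderiv, ModelWithCorners.range_eq_univ, fderivWithin_univ] at h1
      exact h1
    obtain ⟨V, hV, hpV, hVU, g, hg, hfg⟩ := ContDiffOn.exists_eq_mul_of_eq_zero hU'
      (x₀ := φ p) ⟨φ.map_source hpφ, by simpa [φ] using hp⟩ (hcomp hf) (hcomp hz.smooth) hd
      fun y hy hzy => hfZ _ hy.2 ((hz.zero_iff _ hy.2).1 hzy)
    refine ⟨φ.source ∩ φ ⁻¹' V, ?_, ⟨hpφ, hpV⟩, g ∘ φ, ?_, fun x hx => ?_⟩
    · exact (continuousOn_extChartAt p).isOpen_inter_preimage (isOpen_extChartAt_source p) hV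
    · exact (contMDiffOn_iff_contDiffOn.2 hg).comp (hφ.mono inter_subset_left) fun x hx => hx.2
    · have := hfg (φ x) hx.2
      simpa only [Function.comp, φ.left_inv hx.1] using this
  · refine ⟨U ∩ Zᶜ, hU.inter hZ.isClosed.isOpen_compl, ⟨hp, hpZ⟩, fun x => f x / z x,
      fun x hx => ?_, fun x hx => (div_mul_cancel₀ _ (hz.ne_zero hx.1 hx.2)).symm⟩
    exact ((hf.contMDiffAt (hU.mem_nhds hx.1)).div₀ (hz.smooth.contMDiffAt (hU.mem_nhds hx.1))
      (hz.ne_zero hx.1 hx.2)).contMDiffWithinAt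

/-! ### Powers of the vanishing ideal -/

theorem ContMDiffOn.eventually_contMDiffAt (hU : IsOpen U) {f : X → ℝ}
    (hf : ContMDiffOn (𝓡 n) 𝓘(ℝ, ℝ) ∞ f U) {p : X} (hp : p ∈ U) :
    ∀ᶠ x in 𝓝 p, ContMDiffAt (𝓡 n) 𝓘(ℝ, ℝ) ∞ f x := by
  filter_upwards [hU.mem_nhds hp] with x hx using hf.contMDiffAt (hU.mem_nhds hx)

/-- The germ at `p` of a function which is smooth near `p`. -/
def smoothGerm {p : X} (f : X → ℝ) (hf : ∀ᶠ x in 𝓝 p, ContMDiffAt (𝓡 n) 𝓘(ℝ, ℝ) ∞ f x) :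
    smoothGerms n p :=
  ⟨f, f, rfl, hf⟩

theorem vanishingGerms_eq_top (hZ : IsClosed Z) {p : X} (hp : p ∉ Z) :
    vanishingGerms n Z p = ⊤ := by
  rw [Ideal.eq_top_iff_one]
  refine ⟨fun _ => 1, rfl, ?_⟩
  filter_upwards [hZ.isOpen_compl.mem_nhds hp] with x hx hxZ using absurd hxZ hx

theorem IsLocalDefiningFunction.vanishingGerms_eq_span [IsManifold (𝓡 n) ∞ X]
    (hZ : IsHypersurface n Z) (hU : IsOpen U) (hz : IsLocalDefiningFunction n Z U z) {p : X}
    (hp : p ∈ U) :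
    vanishingGerms n Z p =
      Ideal.span {smoothGerm (n := n) z (hz.smooth.eventually_contMDiffAt hU hp)} := by
  apply le_antisymm
  · rintro ⟨_, ⟨f', rfl, hf'⟩⟩ ⟨f, hff', hf⟩
    have hff : f =ᶠ[𝓝 p] f' := Germ.coe_eq.1 hff'
    have h1 : ∀ᶠ x in 𝓝 p, ContMDiffAt (𝓡 n) 𝓘(ℝ, ℝ) ∞ f' x ∧ x ∈ U ∧ (x ∈ Z → f' x = 0) := by
      filter_upwards [hf', hf, hff, hU.mem_nhds hp] with x h1 h2 h3 h4
      exact ⟨h1, h4, fun hx => by rw [← h3, h2 hx]⟩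
    obtain ⟨V, hV, hVo, hpV⟩ := eventually_nhds_iff.1 h1
    obtain ⟨g, hg, hfg⟩ := (hz.mono fun x hx => (hV x hx).2.1).exists_eq_mul hZ hVo
      (f := f') (fun x hx => (hV x hx).1.contMDiffWithinAt) fun x hx => (hV x hx).2.2
    refine Ideal.mem_span_singleton'.2
      ⟨smoothGerm (n := n) g (hg.eventually_contMDiffAt hVo hpV), ?_⟩
    refine Subtype.ext (Germ.coe_eq.2 ?_)
    filter_upwards [hVo.mem_nhds hpV] with x hx using (hfg x hx).symm
  · rw [Ideal.span_singleton_le_iff_mem]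
    refine ⟨z, rfl, ?_⟩
    filter_upwards [hU.mem_nhds hp] with x hx using (hz.zero_iff x hx).2

theorem exists_nhds_eq_mul_pow_of_mem [IsManifold (𝓡 n) ∞ X]
    (hZ : IsHypersurface n Z) (hU : IsOpen U) (hz : IsLocalDefiningFunction n Z U z) {p : X}
    (hp : p ∈ U) {k : ℕ} {φ : smoothGerms n p} (hφ : φ ∈ vanishingGerms n Z p ^ k) {f : X → ℝ}
    (hf : (f : Germ (𝓝 p) ℝ) = φ.1) :
    ∃ W, IsOpen W ∧ p ∈ W ∧ ∃ g : X → ℝ, ContMDiffOn (𝓡 n) 𝓘(ℝ, ℝ) ∞ g W ∧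
      ∀ x ∈ W, f x = g x * z x ^ k := by
  rw [hz.vanishingGerms_eq_span hZ hU hp, Ideal.span_singleton_pow] at hφ
  obtain ⟨⟨_, g, rfl, hg⟩, hgφ⟩ := Ideal.mem_span_singleton'.1 hφ
  have h1 : f =ᶠ[𝓝 p] fun x => g x * z x ^ k :=
    Germ.coe_eq.1 (hf.trans (congrArg Subtype.val hgφ).symm)
  obtain ⟨W, hW, hWo, hpW⟩ := eventually_nhds_iff.1 (hg.and h1)
  exact ⟨W, hWo, hpW, g, fun x hx => (hW x hx).1.contMDiffWithinAt, fun x hx => (hW x hx).2⟩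

/-- Sections of `I_Z ^ k` are the multiples of `z ^ k`: quotients exist on stalks, and they agree on
overlaps because `z` is nonzero on a dense set. -/
theorem IsLocalDefiningFunction.memIdealPow_iff [IsManifold (𝓡 n) ∞ X] (hZ : IsHypersurface n Z)
    (hU : IsOpen U) (hz : IsLocalDefiningFunction n Z U z) (k : ℕ) {f : X → ℝ} :
    MemIdealPow n Z k U f ↔
      ∃ g : X → ℝ, ContMDiffOn (𝓡 n) 𝓘(ℝ, ℝ) ∞ g U ∧ ∀ x ∈ U, f x = g x * z x ^ k := by
  constructor
  · intro h
    refine ContMDiffOn.exists_mul_eq_of_locally hZ.dense_compl hU (f := fun x => z x ^ k)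
      (fun x hx hxZ => pow_ne_zero _ (hz.ne_zero hx hxZ)) fun p hp => ?_
    obtain ⟨φ, hφ, hf⟩ := h p hp
    exact exists_nhds_eq_mul_pow_of_mem hZ hU hz hp hφ hf
  · rintro ⟨g, hg, hfg⟩ p hp
    refine ⟨smoothGerm (n := n) g (hg.eventually_contMDiffAt hU hp) *
      smoothGerm (n := n) z (hz.smooth.eventually_contMDiffAt hU hp) ^ k, ?_, Germ.coe_eq.2 ?_⟩
    · rw [hz.vanishingGerms_eq_span hZ hU hp, Ideal.span_singleton_pow]
      exact Ideal.mul_mem_left _ _ (Ideal.mem_span_singleton_self _)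
    · filter_upwards [hU.mem_nhds hp] with x hx using hfg x hx

/-! ### Jets and the associated vector fields -/

variable {m : ℕ} {j : JetAlong n Z m}

theorem JetAlong.Represents.mono {f : X → ℝ} (h : j.Represents U f) (hW : W ⊆ U) :
    j.Represents W f :=
  ⟨h.1.mono hW, fun q hq => h.2 q (hW hq)⟩

/-- Two functions representing the same jet differ by a multiple of the appropriate power of
a defining function. -/
theorem JetAlong.Represents.exists_eq_add [IsManifold (𝓡 n) ∞ X] (hZ : IsHypersurface n Z)
    (hU : IsOpen U) (hz : IsLocalDefiningFunction n Z U z) (hzj : j.Represents U z) {f : X → ℝ}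
    (hf : j.Represents U f) :
    ∃ h : X → ℝ, ContMDiffOn (𝓡 n) 𝓘(ℝ, ℝ) ∞ h U ∧ ∀ x ∈ U, f x = z x + h x * z x ^ (m + 1) := by
  have key : MemIdealPow n Z (m + 1) U fun x => f x - z x := by
    intro p hp
    by_cases hpZ : p ∈ Z
    · obtain ⟨φ, hφ, hφj⟩ := hf.2 ⟨p, hpZ⟩ hp
      obtain ⟨ψ, hψ, hψj⟩ := hzj.2 ⟨p, hpZ⟩ hp
      refine ⟨φ - ψ, Ideal.Quotient.eq.1 (hφj.trans hψj.symm), ?_⟩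
      change (f : Germ (𝓝 p) ℝ) - (z : Germ (𝓝 p) ℝ) = φ.1 - ψ.1
      rw [hφ, hψ]
    · refine ⟨smoothGerm (n := n) (fun x => f x - z x)
        ((hf.1.sub hzj.1).eventually_contMDiffAt hU hp), ?_, rfl⟩
      rw [vanishingGerms_eq_top hZ.isClosed hpZ, Ideal.top_pow]
      trivial
  obtain ⟨h, hh, hfh⟩ := (hz.memIdealPow_iff hZ hU _).1 key
  exact ⟨h, hh, fun x hx => by rw [← hfh x hx]; ring⟩

/-- For the `b^k`-tangent sheaf it suffices to test one representative `z` of the jet, as any other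
one is `z + h z ^ k`. -/
theorem bkVectorFields_iff [IsManifold (𝓡 n) ∞ X] (hZ : IsHypersurface n Z)
    (hU : IsOpen U) (hz : IsLocalDefiningFunction n Z U z) (hzj : j.Represents U z)
    {v : ∀ x : X, TangentSpace (𝓡 n) x} :
    bkVectorFields (m + 1) j U v ↔ SmoothVectorFieldOn U v ∧
      ∃ g : X → ℝ, ContMDiffOn (𝓡 n) 𝓘(ℝ, ℝ) ∞ g U ∧
        ∀ x ∈ U, lieDerivFun v z x = g x * z x ^ (m + 1) := by
  constructor
  · rintro ⟨hv, h⟩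
    exact ⟨hv, (hz.memIdealPow_iff hZ hU _).1 (h U hU subset_rfl z hzj)⟩
  · rintro ⟨hv, g, hg, hgz⟩
    refine ⟨hv, fun W hW hWU f hf => ?_⟩
    have hzW := hz.mono hWU
    obtain ⟨h, hh, hfh⟩ := (hzj.mono hWU).exists_eq_add hZ hW hzW hf
    rw [hzW.memIdealPow_iff hZ hW]
    have hgW := hg.mono hWU
    refine ⟨fun x => g x + lieDerivFun v h x + h x * ((m + 1) * z x ^ m) * g x, ?_, fun x hx => ?_⟩
    · exact (hgW.add (hh.lieDerivFun hW (hv.mono hWU))).add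
        ((hh.mul (contMDiffOn_const.mul (hzW.smooth.pow m))).mul hgW)
    · have hx' := hW.mem_nhds hx
      have hzx := hzW.smooth.contMDiffAt hx'
      have hhx := hh.contMDiffAt hx'
      have hhz : ContMDiffAt (𝓡 n) 𝓘(ℝ, ℝ) ∞ (fun y => h y * z y ^ (m + 1)) x :=
        hhx.mul (hzx.pow (m + 1))
      rw [lieDerivFun_congr (eventually_of_mem hx' hfh), lieDerivFun_add hzx hhz,
        lieDerivFun_mul hhx (hzx.pow (m + 1)),
        lieDerivFun_pow_succ hzx, hgz x (hWU hx)]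
      ring

end Hypersurface

/-! ### Vector bundles from generically injective local frames -/

/-- An atlas of frames, over the open sets `U p`, of a locally free subsheaf of a family of
vector spaces `T x`: the frames `Φ p x : F → T x` are injective for `x` in the dense set `D`, and
their transition functions `G p q` extend smoothly over the complement of `D`. -/
structure FrameAtlas (n : ℕ) (X : Type*) [TopologicalSpace X]
    [ChartedSpace (EuclideanSpace ℝ (Fin n)) X] (F : Type) [NormedAddCommGroup F] [NormedSpace ℝ F]
    (T : X → Type*) [∀ x, AddCommGroup (T x)] [∀ x, Module ℝ (T x)] (D : Set X) where
  U : X → Set X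
  isOpen : ∀ p, IsOpen (U p)
  mem : ∀ p, p ∈ U p
  Φ : ∀ _p x, F →ₗ[ℝ] T x
  injective : ∀ p, ∀ x ∈ U p, x ∈ D → Function.Injective (Φ p x)
  G : X → X → X → F →L[ℝ] F
  smooth_G : ∀ p q, ContMDiffOn (𝓡 n) 𝓘(ℝ, F →L[ℝ] F) ∞ (G p q) (U p ∩ U q)
  comp_G : ∀ p q, ∀ x ∈ U p ∩ U q, x ∈ D → ∀ a, Φ q x (G p q x a) = Φ p x a
  dense : Dense D

namespace FrameAtlas

variable {n : ℕ} {X : Type*} [TopologicalSpace X] [ChartedSpace (EuclideanSpace ℝ (Fin n)) X]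
  {F : Type} [NormedAddCommGroup F] [NormedSpace ℝ F] {T : X → Type*} [∀ x, AddCommGroup (T x)]
  [∀ x, Module ℝ (T x)] {D : Set X} (Θ : FrameAtlas n X F T D) {W : Set X}

theorem continuousOn_G_apply (p q : X) (a : F) :
    ContinuousOn (fun x => Θ.G p q x a) (Θ.U p ∩ Θ.U q) :=
  (Θ.smooth_G p q).continuousOn.clm_apply continuousOn_const

/-- The vector bundle core with transition functions `G p q`. -/
def core : VectorBundleCore ℝ X F X where
  baseSet := Θ.U
  isOpen_baseSet := Θ.isOpen
  indexAt := id
  mem_baseSet_at := Θ.mem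
  coordChange := Θ.G
  coordChange_self p x hx a := by
    refine ContinuousOn.eqOn_of_dense (U := Θ.U p ∩ Θ.U p) (Θ.continuousOn_G_apply p p a)
      continuousOn_const ((Θ.isOpen p).inter (Θ.isOpen p)) Θ.dense (fun y hy hyD => ?_) x ⟨hx, hx⟩
    exact Θ.injective p y hy.1 hyD (Θ.comp_G p p y hy hyD a)
  continuousOn_coordChange p q := (Θ.smooth_G p q).continuousOn
  coordChange_comp p q r x hx a := by
    have hsub₁ : Θ.U p ∩ Θ.U q ∩ Θ.U r ⊆ Θ.U p ∩ Θ.U q := inter_subset_left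
    have hsub₂ : Θ.U p ∩ Θ.U q ∩ Θ.U r ⊆ Θ.U q ∩ Θ.U r := fun y hy => ⟨hy.1.2, hy.2⟩
    have hsub₃ : Θ.U p ∩ Θ.U q ∩ Θ.U r ⊆ Θ.U p ∩ Θ.U r := fun y hy => ⟨hy.1.1, hy.2⟩
    refine ContinuousOn.eqOn_of_dense
      (((Θ.smooth_G q r).continuousOn.mono hsub₂).clm_apply
        ((Θ.continuousOn_G_apply p q a).mono hsub₁))
      ((Θ.continuousOn_G_apply p r a).mono hsub₃)
      (((Θ.isOpen p).inter (Θ.isOpen q)).inter (Θ.isOpen r)) Θ.dense (fun y hy hyD => ?_) x hx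
    apply Θ.injective r y hy.2 hyD
    rw [Θ.comp_G q r y (hsub₂ hy) hyD, Θ.comp_G p q y (hsub₁ hy) hyD,
      Θ.comp_G p r y (hsub₃ hy) hyD]

instance : Θ.core.IsContMDiff (𝓡 n) ∞ := ⟨Θ.smooth_G⟩

/-- The smooth vector bundle with transition functions `G p q`. Its fibres are copies of `F`, the
fibre at `x` being identified with `F` by the frame with index `x`. -/
def bundle [FiniteDimensional ℝ F] : SmoothVB n X where
  F := F
  E := Θ.core.Fiber

variable [FiniteDimensional ℝ F]

/-- The trivialization of the bundle given by the frame with index `p`. -/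
def trivialization (p : X) :
    Trivialization Θ.bundle.F (TotalSpace.proj : Θ.bundle.Total → X) :=
  Θ.core.localTriv p

instance (p : X) : MemTrivializationAtlas (Θ.trivialization p) := ⟨p, rfl⟩

theorem smoothSectionOn_iff (p : X) (hW : IsOpen W) (hWp : W ⊆ Θ.U p) {s : X → F} :
    Θ.bundle.SmoothSectionOn W s ↔
      ContMDiffOn (𝓡 n) 𝓘(ℝ, F) ∞ (fun x => Θ.G x p x (s x)) W :=
  SmoothVB.smoothSectionOn_iff (A := Θ.bundle) hW (Θ.trivialization p) hWp

/-- Local coordinate functions `h p` with matching images under the frames define a section. -/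
theorem smoothSectionOn_of_compatible (hW : IsOpen W) {h : X → X → F}
    (hh : ∀ p, ContMDiffOn (𝓡 n) 𝓘(ℝ, F) ∞ (h p) (W ∩ Θ.U p))
    (hΦ : ∀ p q, ∀ x ∈ W, x ∈ Θ.U p → x ∈ Θ.U q → x ∈ D → Θ.Φ p x (h p x) = Θ.Φ q x (h q x)) :
    Θ.bundle.SmoothSectionOn W (fun x => h x x) ∧
      ∀ p q, ∀ x ∈ W, x ∈ Θ.U p → x ∈ Θ.U q → Θ.G p q x (h p x) = h q x := by
  have key : ∀ p q, ∀ x ∈ W, x ∈ Θ.U p → x ∈ Θ.U q → Θ.G p q x (h p x) = h q x := by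
    intro p q x hx hxp hxq
    have hsub₁ : W ∩ (Θ.U p ∩ Θ.U q) ⊆ Θ.U p ∩ Θ.U q := inter_subset_right
    refine ContinuousOn.eqOn_of_dense (U := W ∩ (Θ.U p ∩ Θ.U q))
      (((Θ.smooth_G p q).continuousOn.mono hsub₁).clm_apply
        ((hh p).continuousOn.mono fun y hy => ⟨hy.1, hy.2.1⟩))
      ((hh q).continuousOn.mono fun y hy => ⟨hy.1, hy.2.2⟩)
      (hW.inter ((Θ.isOpen p).inter (Θ.isOpen q))) Θ.dense (fun y hy hyD => ?_) x ⟨hx, hxp, hxq⟩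
    apply Θ.injective q y hy.2.2 hyD
    rw [Θ.comp_G p q y hy.2 hyD, hΦ p q y hy.1 hy.2.1 hy.2.2 hyD]
  refine ⟨SmoothVB.smoothSectionOn_of_forall_exists fun p hp => ⟨Θ.U p, Θ.isOpen p, Θ.mem p, ?_⟩,
    key⟩
  rw [Θ.smoothSectionOn_iff p (hW.inter (Θ.isOpen p)) inter_subset_right]
  exact (hh p).congr fun x hx => key x p x hx.1 (Θ.mem x) hx.2

end FrameAtlas

section VectorFields

variable {n : ℕ} {X : Type*} [TopologicalSpace X] [ChartedSpace (EuclideanSpace ℝ (Fin n)) X]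
  [IsManifold (𝓡 n) ∞ X]

/-- A sheaf of smooth vector fields which is locally free, with frames that are generically
frames of the tangent bundle, is the sheaf of sections of a vector bundle. -/
theorem nonempty_bundleOfVectorFields_of_frames
    {V : Set X → (∀ x : X, TangentSpace (𝓡 n) x) → Prop}
    (hVs : ∀ U v, V U v → SmoothVectorFieldOn U v)
    (hVr : ∀ U W v, IsOpen W → W ⊆ U → V U v → V W v)
    (hVl : ∀ U v, (∀ x ∈ U, ∃ W, IsOpen W ∧ x ∈ W ∧ V (U ∩ W) v) → V U v)
    {D : Set X} (hD : Dense D) {F : Type} [NormedAddCommGroup F] [NormedSpace ℝ F]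
    [FiniteDimensional ℝ F]
    (hF : ∀ p : X, ∃ U, IsOpen U ∧ p ∈ U ∧ ∃ Φ : ∀ x : X, F →ₗ[ℝ] TangentSpace (𝓡 n) x,
      (∀ x ∈ U, x ∈ D → Function.Injective (Φ x)) ∧ ∀ W ⊆ U, IsOpen W → ∀ v, V W v ↔
        ∃ h : X → F, ContMDiffOn (𝓡 n) 𝓘(ℝ, F) ∞ h W ∧ ∀ x ∈ W, v x = Φ x (h x)) :
    Nonempty (BundleOfVectorFields V) := by
  choose U hU hpU Φ hinj hΦ using hF
  let b := Module.finBasis ℝ F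
  -- the transition functions express one frame in terms of another
  have hG : ∀ p q : X, ∃ G : X → F →L[ℝ] F,
      ContMDiffOn (𝓡 n) 𝓘(ℝ, F →L[ℝ] F) ∞ G (U p ∩ U q) ∧
      ∀ x ∈ U p ∩ U q, ∀ a, Φ q x (G x a) = Φ p x a := fun p q => by
    have hpq := (hU p).inter (hU q)
    have h1 : ∀ i, ∃ h : X → F, ContMDiffOn (𝓡 n) 𝓘(ℝ, F) ∞ h (U p ∩ U q) ∧
        ∀ x ∈ U p ∩ U q, Φ p x (b i) = Φ q x (h x) := fun i =>
      (hΦ q _ inter_subset_right hpq _).1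
        ((hΦ p _ inter_subset_left hpq _).2 ⟨fun _ => b i, contMDiffOn_const, fun _ _ => rfl⟩)
    choose h hh hΦh using h1
    let c : Fin _ → F →L[ℝ] ℝ := fun i => LinearMap.toContinuousLinearMap (b.coord i)
    refine ⟨fun x => ∑ i, ContinuousLinearMap.smulRightL ℝ F F (c i) (h i x),
      contMDiffOn_finsetSum fun i _ => ?_, fun x hx a => ?_⟩
    · exact (ContinuousLinearMap.contMDiff _).comp_contMDiffOn (hh i)
    · conv_rhs => rw [← b.sum_repr a, map_sum]
      simp [c, hΦh _ x hx]
  choose G hGs hGΦ using hG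
  let Θ : FrameAtlas n X F (fun x => TangentSpace (𝓡 n) x) D :=
    ⟨U, hU, hpU, Φ, hinj, G, hGs, fun p q x hx _ => hGΦ p q x hx, hD⟩
  have hmem : ∀ (W : Set X), IsOpen W → ∀ a : X → F, Θ.bundle.SmoothSectionOn W a →
      ∀ p, V (W ∩ U p) (fun x => Φ x x (a x)) := fun W hW a ha p => by
    refine (hΦ p _ inter_subset_right (hW.inter (hU p)) _).2 ⟨fun x => G x p x (a x), ?_, ?_⟩
    · exact (Θ.smoothSectionOn_iff p (hW.inter (hU p)) inter_subset_right).1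
        (ha.mono inter_subset_left)
    · exact fun x hx => (hGΦ x p x ⟨hpU x, hx.2⟩ _).symm
  refine ⟨⟨Θ.bundle, fun x => Φ x x, ?_, fun W hW a ha => ?_, fun W hW a ha h0 => ?_,
    fun W hW v hv => ?_⟩⟩
  · refine SmoothVB.contMDiff_total_of_sections (A := Θ.bundle) (B := SmoothVB.tangent n X)
      (fun x => Φ x x) fun W hW a ha x hx => ?_
    exact ⟨W ∩ U x, hW.inter (hU x), ⟨hx, hpU x⟩, hVs _ _ (hmem W hW a ha x)⟩
  · exact hVl _ _ fun x hx => ⟨U x, hU x, hpU x, hmem W hW a ha x⟩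
  · refine SmoothVB.SmoothSectionOn.eq_zero_of_dense ha hW hD fun x hx hxD => ?_
    exact hinj x x (hpU x) hxD ((h0 x hx).trans (map_zero _).symm)
  · have h1 : ∀ p, ∃ h : X → F, ContMDiffOn (𝓡 n) 𝓘(ℝ, F) ∞ h (W ∩ U p) ∧
        ∀ x ∈ W ∩ U p, v x = Φ p x (h x) := fun p =>
      (hΦ p _ inter_subset_right (hW.inter (hU p)) v).1
        (hVr _ _ _ (hW.inter (hU p)) inter_subset_left hv)
    choose h hh hvh using h1
    refine ⟨fun x => h x x, (Θ.smoothSectionOn_of_compatible hW hh fun p q x hx hp hq _ => ?_).1,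
      fun x hx => (hvh x x ⟨hx, hpU x⟩).symm⟩
    exact (hvh p x ⟨hx, hp⟩).symm.trans (hvh q x ⟨hx, hq⟩)

end VectorFields

/-! ### Existence of the log- and `b^k`-tangent bundles -/

section Existence

variable {n : ℕ} {X : Type*} [TopologicalSpace X] [ChartedSpace (EuclideanSpace ℝ (Fin n)) X]
  {Z U W : Set X} {z : X → ℝ} {m : ℕ} {j : JetAlong n Z m}

/-- The differential of a function at `x`, as a linear form on the tangent space. -/
def dFun (f : X → ℝ) (x : X) : TangentSpace (𝓡 n) x →ₗ[ℝ] ℝ :=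
  (mfderiv (𝓡 n) 𝓘(ℝ, ℝ) f x).toLinearMap

theorem lieDerivFun_eq_dFun (v : ∀ x : X, TangentSpace (𝓡 n) x) (f : X → ℝ) (x : X) :
    lieDerivFun v f x = dFun f x (v x) :=
  rfl

theorem JetAlong.represents_one : j.Represents Zᶜ fun _ => 1 :=
  ⟨contMDiffOn_const, fun q hq => absurd q.2 hq⟩

/-- Near every point there is a local defining function, in the generalized sense that includes
the constant function `1` away from `Z`, representing a given defining jet. -/
theorem JetAlong.IsDefining.exists_represents (hj : j.IsDefining) (hZ : IsHypersurface n Z)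
    (p : X) : ∃ U, IsOpen U ∧ p ∈ U ∧ ∃ z : X → ℝ, IsLocalDefiningFunction n Z U z ∧
      j.Represents U z := by
  by_cases hp : p ∈ Z
  · exact hj p hp
  · exact ⟨Zᶜ, hZ.isClosed.isOpen_compl, hp, _, isLocalDefiningFunction_one, j.represents_one⟩

/-- The zero jet of order `0`, which every local defining function of `Z` represents. -/
def zeroJet (Z : Set X) : JetAlong n Z 0 where
  val _ := 0
  locally_represented _ := ⟨univ, isOpen_univ, mem_univ _, fun _ => 0, contMDiffOn_const,
    fun _ _ => ⟨0, rfl, map_zero _⟩⟩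

theorem zeroJet_represents_iff (hZ : IsClosed Z) (hU : IsOpen U) {f : X → ℝ} :
    (zeroJet (n := n) Z).Represents U f ↔ MemIdealPow n Z 1 U f := by
  constructor
  · rintro ⟨hf, h⟩ p hp
    by_cases hpZ : p ∈ Z
    · obtain ⟨φ, hφ, h0⟩ := h ⟨p, hpZ⟩ hp
      exact ⟨φ, Ideal.Quotient.eq_zero_iff_mem.1 h0, hφ⟩
    · refine ⟨smoothGerm (n := n) f (hf.eventually_contMDiffAt hU hp), ?_, rfl⟩
      rw [vanishingGerms_eq_top hZ hpZ, Ideal.top_pow]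
      trivial
  · refine fun h => ⟨fun p hp => ?_, fun q hq => ?_⟩
    · obtain ⟨⟨_, g, rfl, hg⟩, -, hfg⟩ := h p hp
      exact (hg.self_of_nhds.congr_of_eventuallyEq (Germ.coe_eq.1 hfg)).contMDiffWithinAt
    · obtain ⟨φ, hφ, hf⟩ := h q hq
      exact ⟨φ, hf, Ideal.Quotient.eq_zero_iff_mem.2 hφ⟩

variable [IsManifold (𝓡 n) ∞ X]

/-- A vector field `w` near a point of `Z` with `dz(w) = 1`. -/
theorem IsLocalDefiningFunction.exists_transverse (hU : IsOpen U)
    (hz : IsLocalDefiningFunction n Z U z) {p : X} (hp : p ∈ U) (hpZ : p ∈ Z) :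
    ∃ W, IsOpen W ∧ p ∈ W ∧ W ⊆ U ∧ ∃ w : ∀ x : X, TangentSpace (𝓡 n) x,
      SmoothVectorFieldOn W w ∧ ∀ x ∈ W, dFun z x (w x) = 1 := by
  obtain ⟨u, hu⟩ : ∃ u, dFun z p u ≠ 0 := by
    by_contra! hc
    exact hz.mfderiv_ne_zero p hp hpZ (ContinuousLinearMap.ext hc)
  obtain ⟨V, hV, hpV, w, hw, rfl⟩ := (SmoothVB.tangent n X).exists_section p u
  have hUV := hU.inter hV
  have hs : ContMDiffOn (𝓡 n) 𝓘(ℝ, ℝ) ∞ (lieDerivFun w z) (U ∩ V) :=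
    (hz.smooth.mono inter_subset_left).lieDerivFun hUV (hw.mono inter_subset_right)
  have hW : IsOpen (U ∩ V ∩ lieDerivFun w z ⁻¹' {0}ᶜ) :=
    hs.continuousOn.isOpen_inter_preimage hUV isOpen_compl_singleton
  refine ⟨_, hW, ⟨⟨hp, hpV⟩, hu⟩, fun x hx => hx.1.1, fun x => (lieDerivFun w z x)⁻¹ • w x,
    SmoothVB.SmoothSectionOn.smul (A := SmoothVB.tangent n X) (fun x hx => ?_)
      (hw.mono fun x hx => hx.1.2), fun x hx => ?_⟩
  · exact (((hs.contMDiffAt (hUV.mem_nhds hx.1))).inv₀ hx.2).contMDiffWithinAt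
  · rw [map_smul, smul_eq_mul, lieDerivFun_eq_dFun]
    exact inv_mul_cancel₀ hx.2

theorem smoothVectorFieldOn_iff_exists_symm
    (e : Trivialization (EuclideanSpace ℝ (Fin n))
      (TotalSpace.proj : (SmoothVB.tangent n X).Total → X)) [MemTrivializationAtlas e]
    (hW : IsOpen W) (he : W ⊆ e.baseSet) {v : ∀ x : X, TangentSpace (𝓡 n) x} :
    SmoothVectorFieldOn W v ↔ ∃ h : X → EuclideanSpace ℝ (Fin n),
      ContMDiffOn (𝓡 n) 𝓘(ℝ, EuclideanSpace ℝ (Fin n)) ∞ h W ∧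
        ∀ x ∈ W, v x = e.symmₗ ℝ x (h x) := by
  constructor
  · intro hv
    refine ⟨fun x => (e ⟨x, v x⟩).2, (SmoothVB.smoothSectionOn_iff hW e he).1 hv, fun x hx => ?_⟩
    rw [e.symmₗ_apply (he hx), e.symm_apply_apply_mk (he hx)]
  · rintro ⟨h, hh, hv⟩
    refine (SmoothVB.smoothSectionOn_symm (A := SmoothVB.tangent n X) e hW he hh).congr
      fun x hx => ?_
    rw [hv x hx, e.symmₗ_apply (he hx)]

theorem bkVectorFields_restrict {k : ℕ} {v : ∀ x : X, TangentSpace (𝓡 n) x} (hW : W ⊆ U)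
    (h : bkVectorFields k j U v) : bkVectorFields k j W v :=
  ⟨h.1.mono hW, fun O hO hOW f hf => h.2 O hO (hOW.trans hW) f hf⟩

theorem bkVectorFields_of_locally {k : ℕ} {v : ∀ x : X, TangentSpace (𝓡 n) x}
    (h : ∀ x ∈ U, ∃ W, IsOpen W ∧ x ∈ W ∧ bkVectorFields k j (U ∩ W) v) :
    bkVectorFields k j U v := by
  refine ⟨SmoothVB.smoothSectionOn_of_forall_exists fun x hx => ?_, fun O hO hOU f hf p hp => ?_⟩
  · obtain ⟨W, hW, hxW, hv⟩ := h x hx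
    exact ⟨W, hW, hxW, hv.1⟩
  · obtain ⟨W, hW, hpW, hv⟩ := h p (hOU hp)
    exact hv.2 (O ∩ W) (hO.inter hW) (inter_subset_inter_left _ hOU) f (hf.mono inter_subset_left)
      p ⟨hp, hpW⟩

/-- A local frame for the sheaf of vector fields `v` with `dz(v) ∈ (z ^ k)`: rescale by `z ^ k` the
component of a frame of the tangent bundle along a vector field `w` with `dz(w) = 1`. -/
theorem exists_frame_bkVectorFields (hZ : IsHypersurface n Z) (hj : j.IsDefining) (p : X) :
    ∃ U, IsOpen U ∧ p ∈ U ∧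
      ∃ Φ : ∀ x : X, EuclideanSpace ℝ (Fin n) →ₗ[ℝ] TangentSpace (𝓡 n) x,
      (∀ x ∈ U, x ∈ Zᶜ → Function.Injective (Φ x)) ∧
      ∀ W ⊆ U, IsOpen W → ∀ v, bkVectorFields (m + 1) j W v ↔
        ∃ h : X → EuclideanSpace ℝ (Fin n),
          ContMDiffOn (𝓡 n) 𝓘(ℝ, EuclideanSpace ℝ (Fin n)) ∞ h W ∧
            ∀ x ∈ W, v x = Φ x (h x) := by
  let e := trivializationAt (EuclideanSpace ℝ (Fin n)) (TangentSpace (𝓡 n) : X → Type _) p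
  have hpe : p ∈ e.baseSet := FiberBundle.mem_baseSet_trivializationAt' p
  have hinj : ∀ x ∈ e.baseSet, Function.Injective (e.symmₗ ℝ x) := fun x hx =>
    Function.LeftInverse.injective (e.linearMapAt_symmₗ hx)
  by_cases hpZ : p ∈ Z
  · obtain ⟨U, hU, hpU, z, hz, hzj⟩ := hj p hpZ
    obtain ⟨V, hV, hpV, hVU, w, hw, hwz⟩ := hz.exists_transverse hU hpU hpZ
    refine ⟨V ∩ e.baseSet, hV.inter e.open_baseSet, ⟨hpV, hpe⟩, fun x => e.symmₗ ℝ x +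
      ((z x ^ (m + 1) - 1) • (dFun z x ∘ₗ e.symmₗ ℝ x)).smulRight (w x), ?_, ?_⟩
    · intro x hx hxZ
      rw [injective_iff_map_eq_zero]
      intro a ha
      simp only [LinearMap.add_apply, LinearMap.smulRight_apply, LinearMap.smul_apply,
        LinearMap.comp_apply, smul_eq_mul] at ha
      have h1 := congrArg (dFun z x) ha
      rw [map_add, map_smul, hwz x hx.1, smul_eq_mul, map_zero] at h1
      have h2 : z x ^ (m + 1) * dFun z x (e.symmₗ ℝ x a) = 0 := by linarith
      have h3 := (mul_eq_zero.1 h2).resolve_left (pow_ne_zero _ (hz.ne_zero (hVU hx.1) hxZ))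
      rw [h3, mul_zero, zero_smul, add_zero] at ha
      exact hinj x hx.2 (ha.trans (map_zero _).symm)
    · intro W hWU hW v
      have hWV : W ⊆ V := hWU.trans inter_subset_left
      have hWe : W ⊆ e.baseSet := hWU.trans inter_subset_right
      have hzW := hz.mono (hWV.trans hVU)
      have hwW : SmoothVectorFieldOn W w := hw.mono hWV
      rw [bkVectorFields_iff hZ hW hzW (hzj.mono (hWV.trans hVU))]
      constructor
      · rintro ⟨hv, g, hg, hgz⟩
        have hu : SmoothVectorFieldOn W fun x => v x + (g x - lieDerivFun v z x) • w x :=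
          SmoothVB.SmoothSectionOn.add hv (SmoothVB.SmoothSectionOn.smul
            (hg.sub (hzW.smooth.lieDerivFun hW hv)) hwW)
        obtain ⟨h, hh, hu⟩ := (smoothVectorFieldOn_iff_exists_symm e hW hWe).1 hu
        refine ⟨h, hh, fun x hx => ?_⟩
        simp only [LinearMap.add_apply, LinearMap.smulRight_apply, LinearMap.smul_apply,
          LinearMap.comp_apply, smul_eq_mul]
        rw [← hu x hx, map_add, map_smul, hwz x (hWV hx), hgz x hx, ← lieDerivFun_eq_dFun,
          hgz x hx, add_assoc, ← add_smul, smul_eq_mul]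
        ring_nf
        simp
      · rintro ⟨h, hh, hv⟩
        have hu : SmoothVectorFieldOn W fun x => e.symmₗ ℝ x (h x) :=
          (smoothVectorFieldOn_iff_exists_symm e hW hWe).2 ⟨h, hh, fun _ _ => rfl⟩
        have hd := hzW.smooth.lieDerivFun hW hu
        refine ⟨SmoothVB.SmoothSectionOn.congr (SmoothVB.SmoothSectionOn.add hu
          (SmoothVB.SmoothSectionOn.smul (((hzW.smooth.pow (m + 1)).sub contMDiffOn_const).mul hd)
            hwW)) hv, _, hd, fun x hx => ?_⟩
        rw [lieDerivFun_eq_dFun, lieDerivFun_eq_dFun, hv x hx]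
        simp only [LinearMap.add_apply, LinearMap.smulRight_apply, LinearMap.smul_apply,
          LinearMap.comp_apply, smul_eq_mul, map_add, map_smul, hwz x (hWV hx)]
        ring
  · refine ⟨Zᶜ ∩ e.baseSet, hZ.isClosed.isOpen_compl.inter e.open_baseSet, ⟨hpZ, hpe⟩,
      fun x => e.symmₗ ℝ x, fun x hx _ => hinj x hx.2, fun W hWU hW v => ?_⟩
    have hWZ : W ⊆ Zᶜ := hWU.trans inter_subset_left
    rw [bkVectorFields_iff hZ hW (isLocalDefiningFunction_one.mono hWZ)
      (j.represents_one.mono hWZ), ← smoothVectorFieldOn_iff_exists_symm e hW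
      (hWU.trans inter_subset_right)]
    refine and_iff_left ⟨fun _ => 0, contMDiffOn_const, fun x _ => ?_⟩
    simp only [lieDerivFun, mfderiv_const, zero_mul]
    rfl

theorem JetAlong.IsDefining.nonempty_bkTangentBundle (hj : j.IsDefining)
    (hZ : IsHypersurface n Z) : Nonempty (BkTangentBundle (m + 1) j) :=
  nonempty_bundleOfVectorFields_of_frames (fun _ _ h => h.1)
    (fun _ _ _ _ hW h => bkVectorFields_restrict hW h) (fun _ _ h => bkVectorFields_of_locally h)
    hZ.dense_compl (exists_frame_bkVectorFields hZ hj)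

theorem zeroJet_isDefining (hZ : IsHypersurface n Z) : (zeroJet (n := n) Z).IsDefining := by
  intro p hp
  obtain ⟨U, hU, hpU, z, hz⟩ := hZ.locally_defined p hp
  refine ⟨U, hU, hpU, z, hz, (zeroJet_represents_iff hZ.isClosed hU).2 ?_⟩
  exact (hz.memIdealPow_iff hZ hU 1).2 ⟨fun _ => 1, contMDiffOn_const, fun x _ => by simp⟩

/-- The log-tangent bundle is the `b`-tangent bundle of the zero jet. -/
theorem logVectorFields_eq_bkVectorFields (hZ : IsHypersurface n Z) :
    logVectorFields (n := n) Z = bkVectorFields 1 (zeroJet (n := n) Z) := by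
  funext U v
  refine propext (and_congr_right fun _ => forall₃_congr fun W hW _ => forall_congr' fun f => ?_)
  rw [zeroJet_represents_iff hZ.isClosed hW]

end Existence

/-! ### Transversality to the zero section -/

section Transversality

/-- The differential at `x` of a map to a normed space, as a linear map to that space. -/
def dVec {E H M E' : Type*} [NormedAddCommGroup E] [NormedSpace ℝ E] [TopologicalSpace H]
    (I : ModelWithCorners ℝ E H) [TopologicalSpace M] [ChartedSpace H M] [NormedAddCommGroup E']
    [NormedSpace ℝ E'] (f : M → E') (x : M) : TangentSpace I x →ₗ[ℝ] E' :=
  (mfderiv I 𝓘(ℝ, E') f x).toLinearMap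

/-- Transport of tangent vectors along an equality of base points, as in `TransverseMaps`, is
invisible to families of functions on the tangent spaces. -/
theorem apply_tangent_cast {E H N Y : Type*} [NormedAddCommGroup E] [NormedSpace ℝ E]
    [TopologicalSpace H] {I : ModelWithCorners ℝ E H} [TopologicalSpace N] [ChartedSpace H N]
    (G : ∀ q : N, TangentSpace I q → Y) {p q : N} (hpq : p = q) (u : TangentSpace I p) :
    G q (hpq ▸ u) = G p u := by
  subst hpq
  rfl

/-- Transversality of `f` and `g` after composition with a map `Q` to a normed space. The splitting
no longer involves transport between tangent spaces of `N`. -/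
theorem TransverseMaps.exists_mfderiv_comp_eq
    {E₁ H₁ E₂ H₂ E₃ H₃ E₄ M M' N : Type*}
    [NormedAddCommGroup E₁] [NormedSpace ℝ E₁] [TopologicalSpace H₁] {I₁ : ModelWithCorners ℝ E₁ H₁}
    [NormedAddCommGroup E₂] [NormedSpace ℝ E₂] [TopologicalSpace H₂] {I₂ : ModelWithCorners ℝ E₂ H₂}
    [NormedAddCommGroup E₃] [NormedSpace ℝ E₃] [TopologicalSpace H₃] {I₃ : ModelWithCorners ℝ E₃ H₃}
    [NormedAddCommGroup E₄] [NormedSpace ℝ E₄]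
    [TopologicalSpace M] [ChartedSpace H₁ M] [TopologicalSpace M'] [ChartedSpace H₂ M']
    [TopologicalSpace N] [ChartedSpace H₃ N]
    {f : M → N} {g : M' → N} (h : TransverseMaps I₁ I₂ I₃ f g) {Q : N → E₄} {x : M} {y : M'}
    (hxy : g y = f x) (hf : MDifferentiableAt I₁ I₃ f x) (hg : MDifferentiableAt I₂ I₃ g y)
    (hQ : MDifferentiableAt I₃ 𝓘(ℝ, E₄) Q (f x)) (w : TangentSpace I₃ (f x)) :
    ∃ (a : TangentSpace I₁ x) (b : TangentSpace I₂ y),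
      dVec I₃ Q (f x) w = dVec I₁ (Q ∘ f) x a + dVec I₂ (Q ∘ g) y b := by
  obtain ⟨a, b, rfl⟩ := h x y hxy w
  refine ⟨a, b, ?_⟩
  have h₁ : dVec I₁ (Q ∘ f) x a = dVec I₃ Q (f x) (mfderiv I₁ I₃ f x a) :=
    congrArg (fun T => T a) (mfderiv_comp x hQ hf)
  have h₂ : dVec I₂ (Q ∘ g) y b = dVec I₃ Q (g y) (mfderiv I₂ I₃ g y b) :=
    congrArg (fun T => T b) (mfderiv_comp y (hxy ▸ hQ) hg)
  rw [h₁, h₂, map_add, apply_tangent_cast (fun q u => dVec I₃ Q q u) hxy]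

variable {n : ℕ} {X : Type*} [TopologicalSpace X] [ChartedSpace (EuclideanSpace ℝ (Fin n)) X]
  {A : SmoothVB n X}

namespace SmoothVB

variable (e : Trivialization A.F (TotalSpace.proj : A.Total → X)) [MemTrivializationAtlas e]

theorem contMDiffAt_snd_trivialization {a : A.Total} (ha : a.1 ∈ e.baseSet) :
    ContMDiffAt ((𝓡 n).prod 𝓘(ℝ, A.F)) 𝓘(ℝ, A.F) ∞ (fun b : A.Total => (e b).2) a :=
  contMDiffAt_snd.comp a ((e.contMDiffOn (IB := 𝓡 n) (n := ∞)).contMDiffAt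
    (e.open_source.mem_nhds (e.mem_source.2 ha)))

/-- Every vector of the typical fibre is the vertical component, in a trivialization, of a tangent
vector of the total space. -/
theorem exists_mfderiv_snd_eq {a : A.Total} (ha : a.1 ∈ e.baseSet) (c : A.F) :
    ∃ w : TangentSpace ((𝓡 n).prod 𝓘(ℝ, A.F)) a,
      dVec ((𝓡 n).prod 𝓘(ℝ, A.F)) (fun b : A.Total => (e b).2) a w = c := by
  have hs : a ∈ e.source := e.mem_source.2 ha
  have ht : (a.1, (e a).2) ∈ e.target := by
    rw [e.mk_proj_snd hs]
    exact e.map_source hs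
  let γ : A.F → A.Total := fun t => e.toOpenPartialHomeomorph.symm (a.1, t)
  have hγa : γ (e a).2 = a := by
    simp only [γ]
    rw [e.mk_proj_snd hs]
    exact e.toOpenPartialHomeomorph.left_inv hs
  have hγ : MDifferentiableAt 𝓘(ℝ, A.F) ((𝓡 n).prod 𝓘(ℝ, A.F)) γ (e a).2 := by
    refine ContMDiffAt.mdifferentiableAt (n := ∞) ?_ (by simp)
    exact ((e.contMDiffOn_symm (IB := 𝓡 n) (n := ∞)).contMDiffAt
      (e.open_target.mem_nhds ht)).comp (e a).2 (contMDiffAt_const.prodMk contMDiffAt_id)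
  have hq := (contMDiffAt_snd_trivialization e ha).mdifferentiableAt (by simp)
  have hid : (fun b : A.Total => (e b).2) ∘ γ = id := by
    funext t
    have : (a.1, t) ∈ e.target := e.mem_target.2 ha
    simp [γ, e.apply_symm_apply this]
  have hcomp := mfderiv_comp (e a).2 (hγa.symm ▸ hq) hγ
  rw [hid, mfderiv_id] at hcomp
  have key : ∀ b, b = a → ∀ u : TangentSpace ((𝓡 n).prod 𝓘(ℝ, A.F)) b,
      ∃ w : TangentSpace ((𝓡 n).prod 𝓘(ℝ, A.F)) a,
        dVec ((𝓡 n).prod 𝓘(ℝ, A.F)) (fun b : A.Total => (e b).2) a w =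
          dVec ((𝓡 n).prod 𝓘(ℝ, A.F)) (fun b : A.Total => (e b).2) b u := by
    rintro b rfl u
    exact ⟨u, rfl⟩
  obtain ⟨w, hw⟩ := key _ hγa (mfderiv 𝓘(ℝ, A.F) ((𝓡 n).prod 𝓘(ℝ, A.F)) γ (e a).2 c)
  exact ⟨w, hw.trans (congrArg (fun T => T c) hcomp).symm⟩

/-- A tangent vector of the total space is determined by its horizontal and vertical components. -/
theorem eq_of_mfderiv_eq {a : A.Total} (ha : a.1 ∈ e.baseSet)
    {w w' : TangentSpace ((𝓡 n).prod 𝓘(ℝ, A.F)) a}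
    (h₁ : mfderiv ((𝓡 n).prod 𝓘(ℝ, A.F)) (𝓡 n) (TotalSpace.proj : A.Total → X) a w =
      mfderiv ((𝓡 n).prod 𝓘(ℝ, A.F)) (𝓡 n) (TotalSpace.proj : A.Total → X) a w')
    (h₂ : dVec ((𝓡 n).prod 𝓘(ℝ, A.F)) (fun b : A.Total => (e b).2) a w =
      dVec ((𝓡 n).prod 𝓘(ℝ, A.F)) (fun b : A.Total => (e b).2) a w') :
    w = w' := by
  have hs : a ∈ e.source := e.mem_source.2 ha
  have he : MDifferentiableAt ((𝓡 n).prod 𝓘(ℝ, A.F)) ((𝓡 n).prod 𝓘(ℝ, A.F)) e a :=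
    ((e.contMDiffOn (IB := 𝓡 n) (n := ∞)).contMDiffAt
      (e.open_source.mem_nhds hs)).mdifferentiableAt (by simp)
  have hes : MDifferentiableAt ((𝓡 n).prod 𝓘(ℝ, A.F)) ((𝓡 n).prod 𝓘(ℝ, A.F))
      e.toOpenPartialHomeomorph.symm (e a) :=
    ((e.contMDiffOn_symm (IB := 𝓡 n) (n := ∞)).contMDiffAt
      (e.open_target.mem_nhds (e.map_source hs))).mdifferentiableAt (by simp)
  have hid : e.toOpenPartialHomeomorph.symm ∘ e =ᶠ[𝓝 a] id := by
    filter_upwards [e.open_source.mem_nhds hs] with b hb using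
      e.toOpenPartialHomeomorph.left_inv hb
  have hprod : (e : A.Total → X × A.F) =ᶠ[𝓝 a] fun b => (b.1, (e b).2) := by
    filter_upwards [e.open_source.mem_nhds hs] with b hb using (e.mk_proj_snd hb).symm
  have hp : MDifferentiableAt ((𝓡 n).prod 𝓘(ℝ, A.F)) (𝓡 n) (TotalSpace.proj : A.Total → X) a :=
    (contMDiffAt_proj (n := ∞) A.E).mdifferentiableAt (by simp)
  have hq := (contMDiffAt_snd_trivialization e ha).mdifferentiableAt (by simp)
  have hd : mfderiv ((𝓡 n).prod 𝓘(ℝ, A.F)) ((𝓡 n).prod 𝓘(ℝ, A.F)) e a w =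
      mfderiv ((𝓡 n).prod 𝓘(ℝ, A.F)) ((𝓡 n).prod 𝓘(ℝ, A.F)) e a w' := by
    rw [hprod.mfderiv_eq, mfderiv_prodMk hp hq]
    exact Prod.ext h₁ h₂
  have hcomp := mfderiv_comp a hes he
  rw [hid.mfderiv_eq, mfderiv_id] at hcomp
  have h := fun u : TangentSpace ((𝓡 n).prod 𝓘(ℝ, A.F)) a => congrArg (fun T => T u) hcomp
  exact (h w).trans ((congrArg (mfderiv ((𝓡 n).prod 𝓘(ℝ, A.F)) ((𝓡 n).prod 𝓘(ℝ, A.F))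
    e.toOpenPartialHomeomorph.symm (e a)) hd).trans (h w').symm)

/-- The smooth section `s`, read in a trivialization, has surjective differential at its zeros
iff it is transverse to the zero section. -/
theorem transverseMaps_zero_iff {s : ∀ x, A.E x} (hs : A.SmoothSectionOn univ s) :
    TransverseMaps (𝓡 n) (𝓡 n) ((𝓡 n).prod 𝓘(ℝ, A.F))
      (fun x => (⟨x, s x⟩ : A.Total)) (fun x => (⟨x, 0⟩ : A.Total)) ↔
    ∀ x, s x = 0 → Function.Surjective
      (dVec (𝓡 n) (fun y => (trivializationAt A.F A.E x ⟨y, s y⟩).2) x) := by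
  have hsx : ∀ x, MDifferentiableAt (𝓡 n) ((𝓡 n).prod 𝓘(ℝ, A.F))
      (fun x => (⟨x, s x⟩ : A.Total)) x := fun x =>
    (hs.contMDiffAt univ_mem).mdifferentiableAt (by simp)
  have h0x : ∀ x, MDifferentiableAt (𝓡 n) ((𝓡 n).prod 𝓘(ℝ, A.F))
      (fun x => (⟨x, 0⟩ : A.Total)) x := fun x =>
    ((contMDiff_zeroSection ℝ A.E (n := ∞)).contMDiffAt).mdifferentiableAt (by simp)
  have hzero : ∀ (x : X) (b : TangentSpace (𝓡 n) x), dVec (𝓡 n)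
      ((fun b => (trivializationAt A.F A.E x b).2) ∘ fun x => (⟨x, 0⟩ : A.Total)) x b = 0 := by
    intro x b
    have h1 : ((fun b => (trivializationAt A.F A.E x b).2) ∘ fun x => (⟨x, 0⟩ : A.Total))
        =ᶠ[𝓝 x] fun _ => 0 := by
      filter_upwards [(trivializationAt A.F A.E x).open_baseSet.mem_nhds
        (FiberBundle.mem_baseSet_trivializationAt' x)] with y hy
      have := (trivializationAt A.F A.E x).zeroSection ℝ hy
      exact congrArg Prod.snd this
    simp only [dVec, h1.mfderiv_eq, mfderiv_const]
    rfl
  constructor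
  · intro h x hx c
    let e := trivializationAt A.F A.E x
    have hxe : x ∈ e.baseSet := FiberBundle.mem_baseSet_trivializationAt' x
    obtain ⟨w, hw⟩ := exists_mfderiv_snd_eq (n := n) e (a := ⟨x, s x⟩) hxe c
    obtain ⟨a, b, hab⟩ := h.exists_mfderiv_comp_eq (x := x) (y := x)
      (Q := fun b : A.Total => (e b).2) (by rw [hx]) (hsx x) (h0x x)
      ((contMDiffAt_snd_trivialization e (a := ⟨x, s x⟩) hxe).mdifferentiableAt (by simp)) w
    refine ⟨a, ?_⟩
    rw [hzero, add_zero, hw] at hab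
    exact hab.symm
  · intro h x y hxy
    obtain rfl : y = x := congrArg TotalSpace.proj hxy
    have hx : s y = 0 := by
      have := hxy
      rw [TotalSpace.mk_inj] at this
      exact this.symm
    intro w
    let e := trivializationAt A.F A.E y
    have hye : y ∈ e.baseSet := FiberBundle.mem_baseSet_trivializationAt' y
    have hQ := (contMDiffAt_snd_trivialization (n := n) e (a := ⟨y, s y⟩) hye).mdifferentiableAt
      (by simp)
    have hQ0 := (contMDiffAt_snd_trivialization (n := n) e (a := ⟨y, 0⟩) hye).mdifferentiableAt
      (by simp)
    have hπ : ∀ a : A.Total, MDifferentiableAt ((𝓡 n).prod 𝓘(ℝ, A.F)) (𝓡 n)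
        (TotalSpace.proj : A.Total → X) a := fun a =>
      (contMDiffAt_proj (n := ∞) A.E).mdifferentiableAt (by simp)
    let dπ : ∀ a : A.Total, TangentSpace ((𝓡 n).prod 𝓘(ℝ, A.F)) a → EuclideanSpace ℝ (Fin n) :=
      fun a u => mfderiv ((𝓡 n).prod 𝓘(ℝ, A.F)) (𝓡 n) (TotalSpace.proj : A.Total → X) a u
    obtain ⟨a, ha⟩ : ∃ a : EuclideanSpace ℝ (Fin n), dVec (𝓡 n) (fun x => (e ⟨x, s x⟩).2) y a =
        dVec ((𝓡 n).prod 𝓘(ℝ, A.F)) (fun b : A.Total => (e b).2) ⟨y, s y⟩ w := h y hx _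
    let b : EuclideanSpace ℝ (Fin n) := dπ _ w - a
    refine ⟨a, b, eq_of_mfderiv_eq e (a := ⟨y, s y⟩) hye ?_ ?_⟩
    · have h₁ := mfderiv_comp y (hπ ⟨y, s y⟩) (hsx y)
      have h₂ := mfderiv_comp y (hπ ⟨y, 0⟩) (h0x y)
      have hid : ∀ t : ∀ x, A.E x, (TotalSpace.proj : A.Total → X) ∘ (fun x => ⟨x, t x⟩) = id :=
        fun _ => rfl
      rw [hid, mfderiv_id] at h₁
      rw [hid (fun _ => 0), mfderiv_id] at h₂
      rw [map_add]
      have h₃ := apply_tangent_cast dπ hxy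
        (mfderiv (𝓡 n) ((𝓡 n).prod 𝓘(ℝ, A.F)) (fun x => (⟨x, 0⟩ : A.Total)) y b)
      have h₄ : dπ _ w = a + b := by simp [b]
      exact h₄.trans (congrArg₂ (fun u v : EuclideanSpace ℝ (Fin n) => u + v)
        (congrArg (fun T => T a) h₁) ((congrArg (fun T => T b) h₂).trans h₃.symm))
    · rw [map_add, apply_tangent_cast
        (fun q u => dVec ((𝓡 n).prod 𝓘(ℝ, A.F)) (fun b : A.Total => (e b).2) q u) hxy]
      have h₁ := congrArg (fun T => T a) (mfderiv_comp y hQ (hsx y))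
      have h₂ := congrArg (fun T => T b) (mfderiv_comp y hQ0 (h0x y))
      have h₃ := (hzero y b).symm.trans h₂
      refine (ha.symm.trans h₁).trans ?_
      exact (add_zero _).symm.trans (congrArg (fun t : A.F => _ + t) h₃)

end SmoothVB
end Transversality

/-! ### Log divisors -/

section LogDivisors

variable {n : ℕ} {X : Type*} [TopologicalSpace X] [ChartedSpace (EuclideanSpace ℝ (Fin n)) X]
  [IsManifold (𝓡 n) ∞ X] {Z U : Set X} {z : X → ℝ}

/-- The line bundle of a hypersurface: its transition functions are the quotients of local
defining functions, which together form a section. -/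
theorem IsHypersurface.exists_logDivisor (hZ : IsHypersurface n Z) :
    ∃ D : LogDivisor n X, D.zeroSet = Z := by
  choose U hU hpU z hz _ using (zeroJet_isDefining hZ).exists_represents hZ
  have hu : ∀ p q, ∃ u : X → ℝ, ContMDiffOn (𝓡 n) 𝓘(ℝ, ℝ) ∞ u (U p ∩ U q) ∧
      ∀ x ∈ U p ∩ U q, z q x = u x * z p x := fun p q =>
    ((hz p).mono inter_subset_left).exists_eq_mul hZ ((hU p).inter (hU q))
      ((hz q).smooth.mono inter_subset_right) fun x hx hxZ => ((hz q).zero_iff x hx.2).2 hxZ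
  choose u hus huz using hu
  let Θ : FrameAtlas n X ℝ (fun _ => ℝ) Zᶜ :=
    { U := U
      isOpen := hU
      mem := hpU
      Φ := fun p x => (z p x)⁻¹ • LinearMap.id
      injective := fun p x hx hxZ a b hab =>
        mul_left_cancel₀ (inv_ne_zero ((hz p).ne_zero hx hxZ)) hab
      G := fun p q x => u p q x • ContinuousLinearMap.id ℝ ℝ
      smooth_G := fun p q => (hus p q).smul contMDiffOn_const
      comp_G := fun p q x hx hxZ a => by
        have h₁ := (hz p).ne_zero hx.1 hxZ
        have h₂ := (hz q).ne_zero hx.2 hxZ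
        have h₃ := huz p q x hx
        simp only [LinearMap.smul_apply, LinearMap.id_apply, smul_eq_mul,
          smul_apply, ContinuousLinearMap.id_apply]
        field_simp
        rw [h₃]
        ring
      dense := hZ.dense_compl }
  obtain ⟨hs, hsz⟩ := Θ.smoothSectionOn_of_compatible isOpen_univ (h := z)
    (fun p => (hz p).smooth.mono inter_subset_right) fun p q x _ hp hq hxZ => by
      have h₁ := (hz p).ne_zero hp hxZ
      have h₂ := (hz q).ne_zero hq hxZ
      simp [Θ, h₁, h₂]
  have hzero : {x | z x x = 0} = Z := by
    ext x
    exact (hz x).zero_iff x (hpU x)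
  refine ⟨⟨Θ.bundle, Module.finrank_self ℝ, fun x => z x x, hs, ?_, ?_⟩, hzero⟩
  · have h1 : {x | z x x = 0} = {x : X | (show Θ.bundle.E x from z x x) = 0} := rfl
    rw [← h1, hzero, hZ.isClosed.isNowhereDense_iff, interior_eq_empty_iff_dense_compl]
    exact hZ.dense_compl
  · refine (SmoothVB.transverseMaps_zero_iff hs).2 fun x hx => ?_
    have hxZ : x ∈ Z := hzero ▸ hx
    let f : X → ℝ := fun y => (trivializationAt Θ.bundle.F Θ.bundle.E x ⟨y, z y y⟩).2
    have h1 : f =ᶠ[𝓝 x] z x := by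
      filter_upwards [(hU x).mem_nhds (hpU x)] with y hy
      exact hsz y x y (mem_univ y) (hpU y) hy
    have h2 : Function.Surjective (dFun (z x) x) := LinearMap.surjective fun h0 =>
      (hz x).mfderiv_ne_zero x (hpU x) hxZ
        (ContinuousLinearMap.ext fun v => congrArg (fun T => T v) h0)
    intro c
    obtain ⟨v, hv⟩ := h2 c
    have h3 : dFun f x v = dFun (z x) x v := lieDerivFun_congr (v := fun _ => v) h1
    exact ⟨v, h3.trans hv⟩

/-- The section of a log divisor is locally the product of a given local defining function and a
frame of the line bundle. -/
theorem LogDivisor.exists_eq_smul (D : LogDivisor n X) (hZ : IsHypersurface n D.zeroSet)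
    (hU : IsOpen U) (hz : IsLocalDefiningFunction n D.zeroSet U z) {p : X} (hp : p ∈ U) :
    ∃ W, IsOpen W ∧ p ∈ W ∧ W ⊆ U ∧ ∃ ε : ∀ x, D.L.E x, D.L.SmoothSectionOn W ε ∧
      (∀ x ∈ W, ε x ≠ 0) ∧ ∀ x ∈ W, D.s x = z x • ε x := by
  by_cases hpZ : p ∈ D.zeroSet
  · let e := trivializationAt D.L.F D.L.E p
    have hpe : p ∈ e.baseSet := FiberBundle.mem_baseSet_trivializationAt' p
    have hO := hU.inter e.open_baseSet
    have hOn := hO.mem_nhds ⟨hp, hpe⟩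
    obtain ⟨l⟩ : Nonempty (D.L.F ≃ₗ[ℝ] ℝ) :=
      FiniteDimensional.nonempty_linearEquiv_of_finrank_eq (by simp [D.rank_one])
    let lc : D.L.F →L[ℝ] ℝ := LinearMap.toContinuousLinearMap l.toLinearMap
    have hy : ContMDiffOn (𝓡 n) 𝓘(ℝ, D.L.F) ∞ (fun x => (e ⟨x, D.s x⟩).2) (U ∩ e.baseSet) :=
      (SmoothVB.smoothSectionOn_iff hO e inter_subset_right).1 (D.smooth.mono (subset_univ _))
    have hf : ContMDiffOn (𝓡 n) 𝓘(ℝ, ℝ) ∞ (fun x => lc (e ⟨x, D.s x⟩).2) (U ∩ e.baseSet) :=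
      lc.contMDiff.comp_contMDiffOn hy
    have hzO := hz.mono (inter_subset_left (t := e.baseSet))
    have he0 : ∀ x ∈ e.baseSet, (e ⟨x, (0 : D.L.E x)⟩).2 = 0 := fun x hx =>
      congrArg Prod.snd (e.zeroSection ℝ hx)
    obtain ⟨g, hg, hgz⟩ := hzO.exists_eq_mul hZ hO hf fun x hx hxZ => by
      have : D.s x = 0 := hxZ
      rw [this, he0 x hx.2, map_zero]
    -- if `g p = 0` the differential of `s` at `p` vanishes, contrary to transversality
    have hgp : g p ≠ 0 := by
      intro hg0
      have hsurj := (SmoothVB.transverseMaps_zero_iff D.smooth).1 D.transverse p hpZ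
      obtain ⟨a, ha⟩ := hsurj (l.symm 1)
      let a' : ∀ x : X, TangentSpace (𝓡 n) x := fun _ => a
      have h1 : lieDerivFun a' (fun x => lc (e ⟨x, D.s x⟩).2) p = 1 := by
        have h2 : HasMFDerivAt (𝓡 n) 𝓘(ℝ, ℝ) (fun x => lc (e ⟨x, D.s x⟩).2) p _ :=
          HasMFDerivAt.comp (I' := 𝓘(ℝ, D.L.F)) p lc.hasMFDerivAt
            ((hy.contMDiffAt hOn).mdifferentiableAt (by simp)).hasMFDerivAt
        refine (congrArg (fun T => T a) h2.mfderiv).trans ?_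
        refine (congrArg lc ha).trans ?_
        exact l.apply_symm_apply 1
      rw [lieDerivFun_congr (eventually_of_mem hOn hgz), lieDerivFun_mul (hg.contMDiffAt hOn)
        (hzO.smooth.contMDiffAt hOn), hg0, (hz.zero_iff p hp).2 hpZ] at h1
      simp at h1
    have hW : IsOpen (U ∩ e.baseSet ∩ g ⁻¹' {0}ᶜ) :=
      hg.continuousOn.isOpen_inter_preimage hO isOpen_compl_singleton
    refine ⟨_, hW, ⟨⟨hp, hpe⟩, hgp⟩, fun x hx => hx.1.1, fun x => g x • e.symm x (l.symm 1),
      SmoothVB.SmoothSectionOn.smul (hg.mono inter_subset_left)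
        (SmoothVB.smoothSectionOn_symm e hW (fun x hx => hx.1.2) contMDiffOn_const), ?_, ?_⟩
    · intro x hx
      refine smul_ne_zero hx.2 fun h0 => ?_
      have h1 := e.apply_mk_symm hx.1.2 (l.symm 1)
      rw [h0] at h1
      have h2 := (congrArg Prod.snd h1).symm.trans (he0 x hx.1.2)
      simp at h2
    · intro x hx
      have h1 : (e ⟨x, D.s x⟩).2 = (z x * g x) • l.symm 1 := by
        apply l.injective
        rw [map_smul, LinearEquiv.apply_symm_apply, smul_eq_mul, mul_one, mul_comm]
        exact hgz x hx.1
      have h2 : e.symm x (e ⟨x, D.s x⟩).2 = D.s x := e.symm_apply_apply_mk hx.1.2 _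
      change D.s x = z x • g x • e.symm x (l.symm 1)
      rw [← h2, h1, smul_smul, ← e.coe_symmₗ (R := ℝ) hx.1.2, map_smul]
  · refine ⟨U ∩ D.zeroSetᶜ, hU.inter hZ.isClosed.isOpen_compl, ⟨hp, hpZ⟩, inter_subset_left,
      fun x => (z x)⁻¹ • D.s x, SmoothVB.SmoothSectionOn.smul (fun x hx => ?_)
        (D.smooth.mono (subset_univ _)), fun x hx => ?_, fun x hx => ?_⟩
    · exact ((hz.smooth.contMDiffAt (hU.mem_nhds hx.1)).inv₀
        (hz.ne_zero hx.1 hx.2)).contMDiffWithinAt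
    · exact smul_ne_zero (inv_ne_zero (hz.ne_zero hx.1 hx.2)) hx.2
    · rw [smul_inv_smul₀ (hz.ne_zero hx.1 hx.2)]

end LogDivisors

/-! ### Tensor powers -/

/-- A family of linear maps on a finite-dimensional space is smooth if its values are. -/
theorem contMDiffAt_clm_of_forall_apply {n : ℕ} {X : Type*} [TopologicalSpace X]
    [ChartedSpace (EuclideanSpace ℝ (Fin n)) X] {F F' : Type*} [NormedAddCommGroup F]
    [NormedSpace ℝ F]
    [FiniteDimensional ℝ F] [NormedAddCommGroup F'] [NormedSpace ℝ F'] {G : X → F →L[ℝ] F'} {p : X}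
    (h : ∀ a, ContMDiffAt (𝓡 n) 𝓘(ℝ, F') ∞ (fun x => G x a) p) :
    ContMDiffAt (𝓡 n) 𝓘(ℝ, F →L[ℝ] F') ∞ G p := by
  let b := Module.finBasis ℝ F
  let c : Fin _ → F →L[ℝ] ℝ := fun i => LinearMap.toContinuousLinearMap (b.coord i)
  have hG : G = fun x => ∑ i, ContinuousLinearMap.smulRightL ℝ F F' (c i) (G x (b i)) := by
    funext x
    ext a
    conv_lhs => rw [← b.sum_repr a, map_sum]
    simp [c]
  rw [hG]
  exact contMDiffAt_finsetSum fun i _ =>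
    (ContinuousLinearMap.contMDiff _).contMDiffAt.comp p (h (b i))

namespace SmoothVB

variable {n : ℕ} {X : Type*} [TopologicalSpace X] [ChartedSpace (EuclideanSpace ℝ (Fin n)) X]
  {A B : SmoothVB n X} {U : Set X}

/-- A section of `Hom(A, B)` is smooth if it takes smooth local sections of `A` to smooth ones of
`B`. -/
theorem smoothSectionOn_hom_of_apply (hU : IsOpen U) {T : ∀ x, (hom A B).E x}
    (h : ∀ W, IsOpen W → W ⊆ U → ∀ a, A.SmoothSectionOn W a →
      B.SmoothSectionOn W fun x => T x (a x)) :
    (hom A B).SmoothSectionOn U T := by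
  intro p hp
  refine ContMDiffAt.contMDiffWithinAt ((contMDiffAt_hom_bundle _).2 ⟨contMDiffAt_id, ?_⟩)
  refine contMDiffAt_clm_of_forall_apply fun a => ?_
  let e₁ := trivializationAt A.F A.E p
  let e₂ := trivializationAt B.F B.E p
  have hp₁ : p ∈ e₁.baseSet := FiberBundle.mem_baseSet_trivializationAt' p
  have hp₂ : p ∈ e₂.baseSet := FiberBundle.mem_baseSet_trivializationAt' p
  have hW := hU.inter (e₁.open_baseSet.inter e₂.open_baseSet)
  have hWn := hW.mem_nhds ⟨hp, hp₁, hp₂⟩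
  have h1 := h _ hW inter_subset_left _
    (smoothSectionOn_symm e₁ hW (fun x hx => hx.2.1) (contMDiffOn_const (c := a)))
  have h2 := ((smoothSectionOn_iff hW e₂ fun x hx => hx.2.2).1 h1).contMDiffAt hWn
  refine h2.congr_of_eventuallyEq ?_
  filter_upwards [hWn] with x hx
  rw [ContinuousLinearMap.inCoordinates_eq hx.2.1 hx.2.2]
  rfl

/-- The decomposable tensor `a ⊗ b`, that is, the map `φ ↦ φ(a) b`. -/
def tmul {x : X} (a : A.E x) (b : B.E x) : (tensor A B).E x :=
  ContinuousLinearMap.smulRight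
    (⟨⟨⟨fun φ => φ a, fun _ _ => rfl⟩, fun _ _ => rfl⟩, continuous_eval_const a⟩ :
      (A.E x →L[ℝ] ℝ) →L[ℝ] ℝ) b

theorem exists_dual_ne_zero {x : X} {a : A.E x} (ha : a ≠ 0) : ∃ φ : A.E x →L[ℝ] ℝ, φ a ≠ 0 := by
  let e := VectorBundle.continuousLinearEquivAt ℝ A.F A.E x
  obtain ⟨φ, hφ⟩ := SeparatingDual.exists_ne_zero (R := ℝ) (e.map_ne_zero_iff.2 ha)
  exact ⟨φ ∘L (e : A.E x →L[ℝ] A.F), hφ⟩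

theorem tmul_ne_zero {x : X} {a : A.E x} {b : B.E x} (ha : a ≠ 0) (hb : b ≠ 0) :
    tmul a b ≠ 0 := by
  intro h
  obtain ⟨φ, hφ⟩ := exists_dual_ne_zero ha
  exact smul_ne_zero hφ hb (congrArg (fun T : (A.E x →L[ℝ] ℝ) →L[ℝ] B.E x => T φ) h)

theorem smul_tmul_smul {x : X} (c d : ℝ) (a : A.E x) (b : B.E x) :
    tmul (c • a) (d • b) = (c * d) • tmul a b := by
  refine ContinuousLinearMap.ext fun φ => ?_
  change φ (c • a) • d • b = (c * d) • φ a • b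
  rw [map_smul, smul_eq_mul, smul_smul, smul_smul]
  congr 1
  ring

theorem SmoothSectionOn.hom_apply {T : ∀ x, (hom A B).E x} {a : ∀ x, A.E x}
    (hT : (hom A B).SmoothSectionOn U T) (ha : A.SmoothSectionOn U a) :
    B.SmoothSectionOn U fun x => T x (a x) :=
  ContMDiffOn.clm_bundle_apply hT ha

theorem SmoothSectionOn.tmul (hU : IsOpen U) {a : ∀ x, A.E x} {b : ∀ x, B.E x}
    (ha : A.SmoothSectionOn U a) (hb : B.SmoothSectionOn U b) :
    (tensor A B).SmoothSectionOn U fun x => tmul (a x) (b x) := by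
  refine smoothSectionOn_hom_of_apply hU fun W _ hWU φ hφ => ?_
  have h1 := SmoothSectionOn.hom_apply hφ (SmoothSectionOn.mono ha hWU)
  exact SmoothSectionOn.smul (smoothSectionOn_trivialLine.1 h1) (SmoothSectionOn.mono hb hWU)

theorem finrank_hom (A B : SmoothVB n X) :
    Module.finrank ℝ (hom A B).F = Module.finrank ℝ A.F * Module.finrank ℝ B.F := by
  rw [← Module.finrank_linearMap ℝ ℝ]
  exact (LinearMap.toContinuousLinearMap (𝕜 := ℝ) (E := A.F) (F' := B.F)).finrank_eq.symm

/-- The power `a ⊗ (a ⊗ (⋯ ⊗ 1))` of a vector. -/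
def tpow {L : SmoothVB n X} {x : X} (a : L.E x) : ∀ k, (L.tensorPow k).E x
  | 0 => (1 : ℝ)
  | k + 1 => tmul a (tpow a k)

theorem smul_tpow {L : SmoothVB n X} {x : X} (c : ℝ) (a : L.E x) (k : ℕ) :
    tpow (c • a) k = c ^ k • tpow a k := by
  induction k with
  | zero => rw [pow_zero, one_smul]; rfl
  | succ k ih =>
    rw [pow_succ', tpow, ih]
    exact smul_tmul_smul c (c ^ k) a (tpow a k)

theorem tpow_ne_zero {L : SmoothVB n X} {x : X} {a : L.E x} (ha : a ≠ 0) (k : ℕ) :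
    tpow a k ≠ 0 := by
  induction k with
  | zero => exact one_ne_zero (α := ℝ)
  | succ k ih => exact tmul_ne_zero ha ih

theorem SmoothSectionOn.tpow {L : SmoothVB n X} (hU : IsOpen U) {a : ∀ x, L.E x}
    (ha : L.SmoothSectionOn U a) (k : ℕ) :
    (L.tensorPow k).SmoothSectionOn U fun x => tpow (a x) k := by
  induction k with
  | zero => exact smoothSectionOn_trivialLine.2 contMDiffOn_const
  | succ k ih => exact SmoothSectionOn.tmul hU ha ih

theorem finrank_tensorPow {L : SmoothVB n X} (hL : Module.finrank ℝ L.F = 1) (k : ℕ) :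
    Module.finrank ℝ (L.tensorPow k).F = 1 := by
  induction k with
  | zero => exact Module.finrank_self ℝ
  | succ k ih =>
    refine (finrank_hom (hom L (trivialLine n X)) (L.tensorPow k)).trans ?_
    rw [finrank_hom, hL, ih, one_mul, mul_one]
    exact Module.finrank_self ℝ

end SmoothVB

/-! ### The isomorphism -/

section Isomorphism

variable {n : ℕ} {X : Type*} [TopologicalSpace X] [ChartedSpace (EuclideanSpace ℝ (Fin n)) X]
  [IsManifold (𝓡 n) ∞ X]

/-- Gluing of fibrewise linear maps by a partition of unity. The glued map takes smooth sections to
smooth sections if the given ones do, and inherits the values on which the given ones agree, even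
after composition with a linear map; similarly for sections which are multiples of a fixed one. -/
theorem SmoothVB.exists_glued_linearMap [T2Space X] [SecondCountableTopology X] {A B : SmoothVB n X}
    {V : X → Set X} (hV : ∀ p, IsOpen (V p)) (hpV : ∀ p, p ∈ V p)
    (T : X → ∀ x, A.E x →ₗ[ℝ] B.E x) :
    ∃ T' : ∀ x, A.E x →ₗ[ℝ] B.E x,
      (∀ U, IsOpen U → ∀ s : ∀ x, A.E x, (∀ p, B.SmoothSectionOn (U ∩ V p) fun x => T p x (s x)) →
        B.SmoothSectionOn U fun x => T' x (s x)) ∧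
      (∀ (x : X) (G : Type) [AddCommGroup G] [Module ℝ G] (ψ : B.E x →ₗ[ℝ] G) (a : A.E x) (b : G),
        (∀ p, x ∈ V p → ψ (T p x a) = b) → ψ (T' x a) = b) ∧
      ∀ U, IsOpen U → ∀ (s : ∀ x, A.E x) (σ : ∀ x, B.E x),
        (∀ p, ∃ f : X → ℝ, ContMDiffOn (𝓡 n) 𝓘(ℝ, ℝ) ∞ f (U ∩ V p) ∧
          ∀ x ∈ U ∩ V p, T p x (s x) = f x • σ x) →
        ∃ f : X → ℝ, ContMDiffOn (𝓡 n) 𝓘(ℝ, ℝ) ∞ f U ∧ ∀ x ∈ U, T' x (s x) = f x • σ x := by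
  have : LocallyCompactSpace X :=
    ChartedSpace.locallyCompactSpace (EuclideanSpace ℝ (Fin n)) X
  obtain ⟨ρ, hρ⟩ := SmoothPartitionOfUnity.exists_isSubordinate (𝓡 n) isClosed_univ V hV
    fun x _ => mem_iUnion.2 ⟨x, hpV x⟩
  have hmem : ∀ x, ∀ i ∈ ρ.finsupport x, x ∈ V i := fun x i hi =>
    hρ i (subset_closure ((ρ.mem_finsupport x).1 hi))
  let T' : ∀ x, A.E x →ₗ[ℝ] B.E x := fun x => ∑ i ∈ ρ.finsupport x, ρ i x • T i x
  have hT' : ∀ x a, T' x a = ∑ i ∈ ρ.finsupport x, ρ i x • T i x a := fun x a => by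
    simp [T', LinearMap.sum_apply]
  refine ⟨T', fun U hU s hs => ?_, fun x G _ _ ψ a b h => ?_, fun U hU s σ h => ?_⟩
  · refine (smoothSectionOn_finsum_partition hV hρ hU hs).congr fun x _ => ?_
    rw [hT']
    exact (finsum_eq_sum_of_support_subset _ fun i hi => by
      rw [ρ.coe_finsupport]
      exact fun h0 => hi (by simp [h0])).symm
  · rw [hT', map_sum, ← one_smul ℝ b, ← ρ.sum_finsupport x (mem_univ x), Finset.sum_smul]
    exact Finset.sum_congr rfl fun i hi => by rw [map_smul, h i (hmem x i hi)]
  · choose f hf hfs using h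
    refine ⟨_, smoothSectionOn_trivialLine.1 (smoothSectionOn_finsum_partition hV hρ hU
      fun i => smoothSectionOn_trivialLine.2 (hf i)), fun x hx => ?_⟩
    rw [hT', ← ρ.sum_finsupport_smul_eq_finsum x f, Finset.sum_smul]
    exact Finset.sum_congr rfl fun i hi => by
      rw [hfs i x ⟨hx, hmem x i hi⟩, smul_assoc]

variable {Z U W : Set X} {m : ℕ} {j : JetAlong n Z m} {M : SmoothVB n X} {σ ε ε' : ∀ x, M.E x}
  {z z' : X → ℝ}

/-- A representative `z` of the jet `j` over `U` and a frame `ε` of the line bundle `M` for which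
`σ = z ^ (m + 1) • ε`. -/
structure IsLocalFactorization (j : JetAlong n Z m) (σ : ∀ x, M.E x) (U : Set X) (z : X → ℝ)
    (ε : ∀ x, M.E x) : Prop where
  isOpen : IsOpen U
  defining : IsLocalDefiningFunction n Z U z
  represents : j.Represents U z
  smooth : M.SmoothSectionOn U ε
  ne_zero : ∀ x ∈ U, ε x ≠ 0
  eq_smul : ∀ x ∈ U, σ x = z x ^ (m + 1) • ε x

omit [IsManifold (𝓡 n) ∞ X] in
theorem IsLocalFactorization.mono (h : IsLocalFactorization j σ U z ε) (hW : IsOpen W)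
    (hWU : W ⊆ U) : IsLocalFactorization j σ W z ε :=
  ⟨hW, h.defining.mono hWU, h.represents.mono hWU, h.smooth.mono hWU,
    fun x hx => h.ne_zero x (hWU hx), fun x hx => h.eq_smul x (hWU hx)⟩

/-- Along `Z` the bundle map `dz ⊗ ε` does not depend on the local factorization. -/
theorem IsLocalFactorization.dFun_smul_eq (hZ : IsHypersurface n Z)
    (h : IsLocalFactorization j σ U z ε) (h' : IsLocalFactorization j σ U z' ε') {p : X}
    (hp : p ∈ U) (hpZ : p ∈ Z) (a : TangentSpace (𝓡 n) p) :
    dFun z' p a • ε' p = dFun z p a • ε p := by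
  obtain ⟨g, hg, hgz⟩ := h.represents.exists_eq_add hZ h.isOpen h.defining h'.represents
  let u : X → ℝ := fun x => 1 + g x * z x ^ m
  have hu : ContMDiffOn (𝓡 n) 𝓘(ℝ, ℝ) ∞ u U :=
    contMDiffOn_const.add (hg.mul (h.defining.smooth.pow m))
  have hz' : ∀ x ∈ U, z' x = u x * z x := fun x hx => by
    rw [hgz x hx]
    change _ = (1 + g x * z x ^ m) * z x
    ring
  have hε : ∀ x ∈ U, ε x = u x ^ (m + 1) • ε' x := by
    refine h.smooth.eq_of_dense (SmoothVB.SmoothSectionOn.smul (hu.pow (m + 1)) h'.smooth) h.isOpen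
      hZ.dense_compl fun x hx hxZ => ?_
    have h0 := pow_ne_zero (m + 1) (h.defining.ne_zero hx hxZ)
    refine smul_right_injective _ h0 ?_
    change z x ^ (m + 1) • ε x = z x ^ (m + 1) • u x ^ (m + 1) • ε' x
    rw [← h.eq_smul x hx, h'.eq_smul x hx, hz' x hx, smul_smul]
    rw [mul_pow, mul_comm]
  have hzp : z p = 0 := (h.defining.zero_iff p hp).2 hpZ
  have hd : dFun z' p a = u p * dFun z p a := by
    have hUn := h.isOpen.mem_nhds hp
    let a' : ∀ x : X, TangentSpace (𝓡 n) x := fun _ => a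
    have h1 : lieDerivFun a' z' p = u p * lieDerivFun a' z p + z p * lieDerivFun a' u p :=
      (lieDerivFun_congr (eventually_of_mem hUn hz')).trans
        (lieDerivFun_mul (hu.contMDiffAt hUn) (h.defining.smooth.contMDiffAt hUn))
    rw [hzp, zero_mul, add_zero] at h1
    exact h1
  -- for `m = 0` the exponent is `1`, otherwise `u p = 1`
  have hup : u p = u p ^ (m + 1) := by
    rcases m with _ | m
    · rw [zero_add, pow_one]
    · simp [u, hzp]
  rw [hd, hε p hp, smul_smul, ← hup, mul_comm]

/-- The local bundle maps `dz ⊗ ε`, glued by a partition of unity. -/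
theorem exists_linearMap_eq_dFun_smul [T2Space X] [SecondCountableTopology X]
    (hZ : IsHypersurface n Z) (hloc : ∀ p, ∃ U z ε, p ∈ U ∧ IsLocalFactorization j σ U z ε) :
    ∃ α : ∀ x, (SmoothVB.tangent n X).E x →ₗ[ℝ] M.E x,
      (∀ U, IsOpen U → ∀ v, SmoothVectorFieldOn U v →
        M.SmoothSectionOn U fun x => α x (v x)) ∧
      (∀ U, IsOpen U → ∀ v, bkVectorFields (m + 1) j U v →
        ∃ f : X → ℝ, ContMDiffOn (𝓡 n) 𝓘(ℝ, ℝ) ∞ f U ∧ ∀ x ∈ U, α x (v x) = f x • σ x) ∧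
      ∀ U z ε, IsLocalFactorization j σ U z ε → ∀ p ∈ U, p ∈ Z → ∀ a,
        α p a = dFun z p a • ε p := by
  choose V z ε hpV h using hloc
  obtain ⟨α, h1, h2, h3⟩ := SmoothVB.exists_glued_linearMap (A := SmoothVB.tangent n X) (B := M)
    (fun p => (h p).isOpen) hpV fun p x => (dFun (z p) x).smulRight (ε p x)
  refine ⟨α, fun U hU v hv => h1 U hU v fun p => ?_, fun U hU v hv => h3 U hU v σ fun p => ?_,
    fun U z' ε' h' p hp hpZ a => h2 p _ LinearMap.id a _ fun q hq => ?_⟩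
  · have hUV := hU.inter (h p).isOpen
    exact SmoothVB.SmoothSectionOn.smul (ContMDiffOn.lieDerivFun hUV
      ((h p).defining.smooth.mono inter_subset_right) (hv.mono inter_subset_left))
      ((h p).smooth.mono inter_subset_right)
  · have hp := (h p).mono (hU.inter (h p).isOpen) inter_subset_right
    obtain ⟨-, f, hf, hfz⟩ := (bkVectorFields_iff hZ hp.isOpen hp.defining hp.represents).1
      (bkVectorFields_restrict inter_subset_left hv)
    refine ⟨f, hf, fun x hx => ?_⟩
    change lieDerivFun v (z p) x • ε p x = _
    rw [hfz x hx, hp.eq_smul x hx, smul_smul]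
  · have hO := h'.isOpen.inter (h q).isOpen
    exact (h'.mono hO inter_subset_left).dFun_smul_eq hZ ((h q).mono hO inter_subset_right)
      ⟨hp, hq⟩ hpZ a

variable {α : ∀ x, (SmoothVB.tangent n X).E x →ₗ[ℝ] M.E x}

/-- Near a point of `Z`, the bundle map `α` does not vanish on a field transverse to `Z`. -/
theorem IsLocalFactorization.exists_transverse (hM : Module.finrank ℝ M.F = 1)
    (hα : ∀ U, IsOpen U → ∀ v, SmoothVectorFieldOn U v → M.SmoothSectionOn U fun x => α x (v x))
    (hαZ : ∀ U z ε, IsLocalFactorization j σ U z ε → ∀ p ∈ U, p ∈ Z → ∀ a,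
      α p a = dFun z p a • ε p)
    (h : IsLocalFactorization j σ U z ε) {p : X} (hp : p ∈ U) (hpZ : p ∈ Z) :
    ∃ W, IsOpen W ∧ p ∈ W ∧ W ⊆ U ∧ ∃ w, SmoothVectorFieldOn W w ∧
      (∀ x ∈ W, dFun z x (w x) = 1) ∧ ∃ c : X → ℝ, ContMDiffOn (𝓡 n) 𝓘(ℝ, ℝ) ∞ c W ∧
        (∀ x ∈ W, c x ≠ 0) ∧ ∀ x ∈ W, α x (w x) = c x • ε x := by
  obtain ⟨W, hW, hpW, hWU, w, hw, hwz⟩ := h.defining.exists_transverse h.isOpen hp hpZ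
  let c : X → ℝ := fun x => SmoothVB.lineCoeff hM (ε x) (α x (w x))
  have hc : ContMDiffOn (𝓡 n) 𝓘(ℝ, ℝ) ∞ c W := SmoothVB.SmoothSectionOn.lineCoeff hM hW
    (h.smooth.mono hWU) (hα W hW w hw) fun x hx => h.ne_zero x (hWU hx)
  have hcε : ∀ x ∈ W, α x (w x) = c x • ε x := fun x hx =>
    (SmoothVB.lineCoeff_smul hM (h.ne_zero x (hWU hx)) _).symm
  have hcp : c p ≠ 0 := by
    intro h0
    have h1 := hcε p hpW
    rw [h0, zero_smul, hαZ U z ε h p hp hpZ, hwz p hpW, one_smul] at h1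
    exact h.ne_zero p hp h1
  exact ⟨W ∩ c ⁻¹' {0}ᶜ, hc.continuousOn.isOpen_inter_preimage hW isOpen_compl_singleton,
    ⟨hpW, hcp⟩, inter_subset_left.trans hWU, w, hw.mono inter_subset_left,
    fun x hx => hwz x hx.1, c, hc.mono inter_subset_left, fun x hx => hx.2,
    fun x hx => hcε x hx.1⟩

/-- If `α v` is a multiple of `σ`, then `v` belongs to the `b^k`-tangent sheaf: near `Z`, split `v`
into a field of that sheaf and a multiple `d w` of a transverse field `w`. Then `α (d w)` is a
multiple of `σ = z ^ k ε`, while `α w` is nonzero, so that `d` is a multiple of `z ^ k`. -/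
theorem bkVectorFields_of_add_smul_eq_zero (hZ : IsHypersurface n Z)
    (hM : Module.finrank ℝ M.F = 1) (hloc : ∀ p, ∃ U z ε, p ∈ U ∧ IsLocalFactorization j σ U z ε)
    (hα : ∀ U, IsOpen U → ∀ v, SmoothVectorFieldOn U v → M.SmoothSectionOn U fun x => α x (v x))
    (hαV : ∀ U, IsOpen U → ∀ v, bkVectorFields (m + 1) j U v →
        ∃ f : X → ℝ, ContMDiffOn (𝓡 n) 𝓘(ℝ, ℝ) ∞ f U ∧ ∀ x ∈ U, α x (v x) = f x • σ x)
    (hαZ : ∀ U z ε, IsLocalFactorization j σ U z ε → ∀ p ∈ U, p ∈ Z → ∀ a,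
      α p a = dFun z p a • ε p)
    (hU : IsOpen U) {v : ∀ x : X, TangentSpace (𝓡 n) x} (hv : SmoothVectorFieldOn U v)
    {f : X → ℝ} (hf : ContMDiffOn (𝓡 n) 𝓘(ℝ, ℝ) ∞ f U)
    (hvf : ∀ x ∈ U, α x (v x) + f x • σ x = 0) : bkVectorFields (m + 1) j U v := by
  refine bkVectorFields_of_locally fun p hp => ?_
  by_cases hpZ : p ∈ Z
  · obtain ⟨V, z, ε, hpV, h⟩ := hloc p
    obtain ⟨W', hW', hpW', hWV', w, hw, hwz, c, hc, hc0, hcw⟩ :=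
      h.exists_transverse hM hα hαZ hpV hpZ
    refine ⟨W', hW', hpW', ?_⟩
    have hW := hU.inter hW'
    have hWW' : U ∩ W' ⊆ W' := inter_subset_right
    have hvW : SmoothVectorFieldOn (U ∩ W') v := hv.mono inter_subset_left
    have hfW := hf.mono (inter_subset_left (t := W'))
    replace h := h.mono hW (hWW'.trans hWV')
    let d : X → ℝ := lieDerivFun v z
    have hd : ContMDiffOn (𝓡 n) 𝓘(ℝ, ℝ) ∞ d (U ∩ W') :=
      ContMDiffOn.lieDerivFun hW h.defining.smooth hvW
    -- subtracting the transverse part of `v` leaves a field of the `b^k`-tangent bundle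
    have hv₀ : bkVectorFields (m + 1) j (U ∩ W') fun x => v x - d x • w x := by
      refine (bkVectorFields_iff hZ hW h.defining h.represents).2
        ⟨SmoothVB.SmoothSectionOn.sub hvW (SmoothVB.SmoothSectionOn.smul hd (hw.mono hWW')),
          fun _ => 0, contMDiffOn_const, fun x hx => ?_⟩
      rw [lieDerivFun_eq_dFun, map_sub, map_smul, hwz x hx.2, smul_eq_mul, mul_one, zero_mul]
      exact sub_self _
    obtain ⟨g, hg, hgσ⟩ := hαV _ hW _ hv₀
    refine (bkVectorFields_iff hZ hW h.defining h.represents).2 ⟨hvW, fun x => -(f x + g x) / c x,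
      (hfW.add hg).neg.div₀ (hc.mono hWW') fun x hx => hc0 x hx.2, fun x hx => ?_⟩
    have h1 := hgσ x hx
    rw [map_sub, map_smul, hcw x hx.2, eq_neg_of_add_eq_zero_left (hvf x hx.1), h.eq_smul x hx,
      ← sub_eq_zero, smul_smul, smul_smul, smul_smul, ← neg_smul, ← sub_smul, ← sub_smul,
      smul_eq_zero_iff_left (h.ne_zero x hx)] at h1
    change d x = _
    have h2 := hc0 x hx.2
    field_simp
    linarith
  · refine ⟨Zᶜ, hZ.isClosed.isOpen_compl, hpZ, ?_⟩
    have hO := hU.inter hZ.isClosed.isOpen_compl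
    refine (bkVectorFields_iff hZ hO (isLocalDefiningFunction_one.mono inter_subset_right)
      (j.represents_one.mono inter_subset_right)).2 ⟨hv.mono inter_subset_left,
        lieDerivFun v fun _ => 1,
        ContMDiffOn.lieDerivFun hO contMDiffOn_const (hv.mono inter_subset_left), fun x _ => ?_⟩
    rw [one_pow, mul_one]

/-- The `b^k`-tangent bundle is the kernel of the surjection `(v, f) ↦ α v + f σ` from `TX ⊕ ℝ` to
`M`, and a splitting of this surjection gives the isomorphism. -/
theorem nonempty_iso_of_isLocalFactorization [T2Space X] [SecondCountableTopology X]
    (hZ : IsHypersurface n Z) (hM : Module.finrank ℝ M.F = 1)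
    (hσ : M.SmoothSectionOn univ σ)
    (hloc : ∀ p, ∃ U z ε, p ∈ U ∧ IsLocalFactorization j σ U z ε)
    (A : BkTangentBundle (m + 1) j) :
    Nonempty ((A.bundle.sum M).Iso
      ((SmoothVB.tangent n X).sum (SmoothVB.trivialLine n X))) := by
  obtain ⟨α, hα, hαV, hαZ⟩ := exists_linearMap_eq_dFun_smul hZ hloc
  let N := (SmoothVB.tangent n X).sum (SmoothVB.trivialLine n X)
  let φ : ∀ x, N.E x →ₗ[ℝ] M.E x := fun x =>
    (α x).coprod (LinearMap.toSpanSingleton ℝ (M.E x) (σ x))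
  have hφ : ∀ x (b : N.E x), φ x b = α x b.1 + (show ℝ from b.2) • σ x := fun x b => rfl
  have hσ0 : ∀ x, x ∉ Z → σ x ≠ 0 := fun x hxZ => by
    obtain ⟨U, z, ε, hxU, h⟩ := hloc x
    rw [h.eq_smul x hxU]
    exact smul_ne_zero (pow_ne_zero _ (h.defining.ne_zero hxU hxZ)) (h.ne_zero x hxU)
  have hφs : ∀ U, IsOpen U → ∀ b, N.SmoothSectionOn U b →
      M.SmoothSectionOn U fun x => φ x (b x) := fun U hU b hb => by
    obtain ⟨h1, h2⟩ := SmoothVB.smoothSectionOn_sum.1 hb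
    exact SmoothVB.SmoothSectionOn.add (hα U hU _ h1) (SmoothVB.SmoothSectionOn.smul
      (SmoothVB.smoothSectionOn_trivialLine.1 h2) (hσ.mono (subset_univ U)))
  -- `φ` is surjective: along `Z` by a transverse field, elsewhere because `σ ≠ 0`
  have hb : ∀ p, ∃ V, IsOpen V ∧ p ∈ V ∧ ∃ b, N.SmoothSectionOn V b ∧
      ∀ x ∈ V, φ x (b x) ≠ 0 := fun p => by
    by_cases hpZ : p ∈ Z
    · obtain ⟨U, z, ε, hpU, h⟩ := hloc p
      obtain ⟨W, hW, hpW, hWU, w, hw, -, c, -, hc0, hcw⟩ := h.exists_transverse hM hα hαZ hpU hpZ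
      refine ⟨W, hW, hpW, fun x => (w x, (0 : ℝ)), SmoothVB.smoothSectionOn_sum.2
        ⟨hw, SmoothVB.smoothSectionOn_trivialLine.2 contMDiffOn_const⟩, fun x hx => ?_⟩
      rw [hφ]
      change α x (w x) + (0 : ℝ) • σ x ≠ 0
      rw [zero_smul, add_zero, hcw x hx]
      exact smul_ne_zero (hc0 x hx) (h.ne_zero x (hWU hx))
    · refine ⟨Zᶜ, hZ.isClosed.isOpen_compl, hpZ, fun x => (0, (1 : ℝ)),
        SmoothVB.smoothSectionOn_sum.2 ⟨SmoothVB.smoothSectionOn_zero,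
          SmoothVB.smoothSectionOn_trivialLine.2 contMDiffOn_const⟩, fun x hx => ?_⟩
      rw [hφ]
      change α x 0 + (1 : ℝ) • σ x ≠ 0
      rw [map_zero, zero_add, one_smul]
      exact hσ0 x hx
  choose V hV hpV b hb hb0 using hb
  obtain ⟨S, hS, hφS, -⟩ := SmoothVB.exists_glued_linearMap (A := M) (B := N) hV hpV
    fun p x => (SmoothVB.lineCoeff hM (φ x (b p x))).smulRight (b p x)
  have hSs : ∀ U, IsOpen U → ∀ e, M.SmoothSectionOn U e →
      N.SmoothSectionOn U fun x => S x (e x) := fun U hU e he => by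
    refine hS U hU e fun p => ?_
    have hO := hU.inter (hV p)
    have hbO := (hb p).mono (inter_subset_right (s := U))
    exact SmoothVB.SmoothSectionOn.smul (SmoothVB.SmoothSectionOn.lineCoeff hM hO (hφs _ hO _ hbO)
      (he.mono inter_subset_left) fun x hx => hb0 p x hx.2) hbO
  replace hφS : ∀ x (e : M.E x), φ x (S x e) = e := fun x e => by
    refine hφS x (M.E x) (φ x) e e fun p hp => ?_
    rw [LinearMap.smulRight_apply, map_smul]
    exact SmoothVB.lineCoeff_smul hM (hb0 p x hp) e
  -- the correspondence `(a, e) ↔ (anchor a, f) + S e` with `α (anchor a) + f σ = 0`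
  let P : ∀ x, Submodule ℝ ((A.bundle.sum M).E x × N.E x) := fun x =>
    { carrier := {q | A.anchor x q.1.1 = (q.2 - S x q.1.2).1 ∧ φ x q.2 = q.1.2}
      add_mem' := by
        rintro q r ⟨h1, h2⟩ ⟨h3, h4⟩
        refine ⟨?_, ?_⟩
        · change A.anchor x (q.1.1 + r.1.1) = (q.2 + r.2 - S x (q.1.2 + r.1.2)).1
          rw [map_add, map_add, h1, h3, add_sub_add_comm]
          rfl
        · change φ x (q.2 + r.2) = q.1.2 + r.1.2
          rw [map_add, h2, h4]
      zero_mem' := by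
        refine ⟨?_, map_zero (φ x)⟩
        change A.anchor x 0 = (0 - S x 0).1
        rw [map_zero, map_zero, sub_zero]
        rfl
      smul_mem' := by
        rintro c q ⟨h1, h2⟩
        refine ⟨?_, ?_⟩
        · change A.anchor x (c • q.1.1) = (c • q.2 - S x (c • q.1.2)).1
          rw [map_smul, map_smul, h1, ← smul_sub]
          rfl
        · change φ x (c • q.2) = c • q.1.2
          rw [map_smul, h2] }
  refine SmoothVB.nonempty_iso_of_correspondence P ?_ ?_ ?_ ?_
  · intro U hU q hq
    obtain ⟨ha, he⟩ := SmoothVB.smoothSectionOn_sum.1 hq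
    have hv := A.anchor_mem U hU _ ha
    obtain ⟨f, hf, hfσ⟩ := hαV U hU _ hv
    let b₀ : ∀ x, N.E x := fun x => (A.anchor x (q x).1, -f x)
    have hb₀ : N.SmoothSectionOn U b₀ := SmoothVB.smoothSectionOn_sum.2
      ⟨hv.1, SmoothVB.smoothSectionOn_trivialLine.2 hf.neg⟩
    refine ⟨fun x => b₀ x + S x (q x).2, SmoothVB.SmoothSectionOn.add hb₀ (hSs U hU _ he),
      fun x hx => ⟨?_, ?_⟩⟩
    · change A.anchor x (q x).1 = (b₀ x + S x (q x).2 - S x (q x).2).1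
      rw [add_sub_cancel_right]
    · change φ x (b₀ x + S x (q x).2) = (q x).2
      rw [map_add, hφS, hφ]
      change α x (A.anchor x (q x).1) + (-f x) • σ x + (q x).2 = (q x).2
      rw [hfσ x hx, neg_smul, add_neg_cancel, zero_add]
  · intro U hU d hd
    have he := hφs U hU d hd
    have hr := SmoothVB.SmoothSectionOn.sub hd (hSs U hU _ he)
    obtain ⟨h1, h2⟩ := SmoothVB.smoothSectionOn_sum.1 hr
    have hv := bkVectorFields_of_add_smul_eq_zero hZ hM hloc hα hαV hαZ hU h1
      (SmoothVB.smoothSectionOn_trivialLine.1 h2) fun x _ => by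
        refine (hφ x (d x - S x (φ x (d x)))).symm.trans ?_
        rw [map_sub, hφS, sub_self]
    obtain ⟨a, ha, hav⟩ := A.anchor_surjective U hU _ hv
    exact ⟨fun x => (a x, φ x (d x)), SmoothVB.smoothSectionOn_sum.2 ⟨ha, he⟩,
      fun x hx => ⟨hav x hx, rfl⟩⟩
  · intro U hU q hq hP x hx
    obtain ⟨ha, -⟩ := SmoothVB.smoothSectionOn_sum.1 hq
    have h2 : ∀ x ∈ U, (q x).2 = 0 := fun x hx => (hP x hx).2.symm.trans (map_zero (φ x))
    refine Prod.ext (A.anchor_injective U hU _ ha (fun y hy => ?_) x hx) (h2 x hx)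
    refine (hP y hy).1.trans ?_
    change (0 - S y (q y).2).1 = 0
    rw [h2 y hy, map_zero, sub_zero]
    rfl
  · intro U hU d hd hP
    have h1 : ∀ x ∈ U, (d x).1 = 0 := fun x hx => by
      have h := (hP x hx).1
      change A.anchor x 0 = (d x - S x 0).1 at h
      rw [map_zero, map_zero, sub_zero] at h
      exact h.symm
    refine hd.eq_zero_of_dense hU hZ.dense_compl fun x hx hxZ => ?_
    have h2 := (hφ x (d x)).symm.trans (hP x hx).2
    rw [h1 x hx, map_zero, zero_add] at h2
    exact Prod.ext (h1 x hx) ((smul_eq_zero_iff_left (hσ0 x hxZ)).1 h2)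

theorem LogDivisor.exists_isLocalFactorization (D : LogDivisor n X)
    (hZ : IsHypersurface n D.zeroSet) {j : JetAlong n D.zeroSet m} (hj : j.IsDefining) (p : X) :
    ∃ U z ε, p ∈ U ∧ IsLocalFactorization j (M := D.L.tensorPow (m + 1))
      (fun x => SmoothVB.tpow (D.s x) (m + 1)) U z ε := by
  obtain ⟨U, hU, hpU, z, hz, hzj⟩ := hj.exists_represents hZ p
  obtain ⟨W, hW, hpW, hWU, ε, hε, hε0, hεs⟩ := D.exists_eq_smul hZ hU hz hpU
  exact ⟨W, z, fun x => SmoothVB.tpow (ε x) (m + 1), hpW, hW, hz.mono hWU, hzj.mono hWU,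
    SmoothVB.SmoothSectionOn.tpow hW hε (m + 1), fun x hx => SmoothVB.tpow_ne_zero (hε0 x hx) _,
    fun x hx => by rw [hεs x hx, SmoothVB.smul_tpow]⟩

theorem LogDivisor.exists_isLocalFactorization_zeroJet (D : LogDivisor n X)
    (hZ : IsHypersurface n D.zeroSet) (p : X) :
    ∃ U z ε, p ∈ U ∧ IsLocalFactorization (zeroJet (n := n) D.zeroSet) D.s U z ε := by
  obtain ⟨U, hU, hpU, z, hz, hzj⟩ := (zeroJet_isDefining hZ).exists_represents hZ p
  obtain ⟨W, hW, hpW, hWU, ε, hε, hε0, hεs⟩ := D.exists_eq_smul hZ hU hz hpU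
  exact ⟨W, z, ε, hpW, hW, hz.mono hWU, hzj.mono hWU, hε, hε0,
    fun x hx => by rw [hεs x hx, zero_add, pow_one]⟩

end Isomorphism

end

theorem mainTheorem7 {n : ℕ} {X : Type*} [TopologicalSpace X] [T2Space X]
    [SecondCountableTopology X] [ChartedSpace (EuclideanSpace ℝ (Fin n)) X]
    [IsManifold (𝓡 n) ∞ X] (Z : Set X) (hZ : IsHypersurface n Z) :
    -- the log divisor line bundle and the log-tangent bundle exist
    (∃ D : LogDivisor n X, D.zeroSet = Z) ∧
    Nonempty (LogTangentBundle (n := n) Z) ∧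
    -- `A_Z ⊕ L_Z ≅ TX ⊕ ℝ`
    (∀ (D : LogDivisor n X) (A : LogTangentBundle (n := n) Z), D.zeroSet = Z →
      Nonempty ((A.bundle.sum D.L).Iso
        ((SmoothVB.tangent n X).sum (SmoothVB.trivialLine n X)))) ∧
    -- the same for the `b^k`-tangent bundles
    (∀ k : ℕ, 1 ≤ k → ∀ j : JetAlong n Z (k - 1), j.IsDefining →
      Nonempty (BkTangentBundle k j) ∧
      ∀ (D : LogDivisor n X) (A : BkTangentBundle k j), D.zeroSet = Z →
        Nonempty ((A.bundle.sum (D.L.tensorPow k)).Iso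
          ((SmoothVB.tangent n X).sum (SmoothVB.trivialLine n X)))) := by
  have hlog := logVectorFields_eq_bkVectorFields hZ
  refine ⟨hZ.exists_logDivisor, ?_, ?_, ?_⟩
  · change Nonempty (BundleOfVectorFields (logVectorFields (n := n) Z))
    rw [hlog]
    exact (zeroJet_isDefining hZ).nonempty_bkTangentBundle hZ
  · change ∀ (D : LogDivisor n X) (A : BundleOfVectorFields (logVectorFields (n := n) Z)), _
    rw [hlog]
    rintro D A rfl
    exact nonempty_iso_of_isLocalFactorization hZ D.rank_one D.smooth
      (D.exists_isLocalFactorization_zeroJet hZ) A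
  · intro k hk j hj
    obtain ⟨m, rfl⟩ := Nat.exists_eq_add_of_le' hk
    refine ⟨JetAlong.IsDefining.nonempty_bkTangentBundle (m := m) hj hZ, ?_⟩
    rintro D A rfl
    exact nonempty_iso_of_isLocalFactorization (m := m) hZ
      (SmoothVB.finrank_tensorPow D.rank_one _)
      (SmoothVB.SmoothSectionOn.tpow isOpen_univ D.smooth (m + 1))
      (D.exists_isLocalFactorization (m := m) hZ hj) A
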